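/- For a cardinal $\kappa$ let $\mathcal B(\kappa)$ be the Maharam measure algebra of dimension $\kappa$, i.e. the measurable subsets of $\{0,1\}^{\kappa}$ modulo null sets for the fair coin-tossing product measure, with measure $\mathrm{Leb}$. The dimension of a Boolean subalgebra of a (probability) measure algebra is the Maharam type of the complete subalgebra it generates, i.e. the least cardinality of a set completely generating the latter; the dimension of a measure is that of its measure algebra. A subset of a Boolean algebra is independent (free) if every nontrivial Boolean combination of finitely many of its members is nonzero. Let $\langle (a_\alpha,b_\alpha):\alpha<\lambda\rangle$ be a sequence of pairs with $a_\alpha\le b_\alpha$ in a Boolean algebra $\mathbf B$. It is strongly $\lambda$-anti-independent if, for every Boolean algebra $\mathbf B'$ extending $\mathbf B$, every $X\subseteq\lambda$ of cardinality $\lambda$ and all $x_\alpha\in\mathbf B'$ with $a_\alpha\le x_\alpha\le b_\alpha$ $(\alpha\in X)$, the subalgebra of $\mathbf B'$ generated by $\{x_\alpha:\alpha\in X\}$ contains no independent subset of cardinality $\lambda$. The free extension of $\mathbf B$ for the sequence is the Boolean algebra freely generated by $\mathbf B\cup\{x_\alpha:\alpha<\lambda\}$ subject to the equations of $\mathbf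 B$ and to $a_\alpha\le x_\alpha\le b_\alpha$. The sequence is mediumly $\lambda$-anti-independent if, in the free extension, the subalgebra generated by $\{x_\alpha:\alpha<\lambda\}$ contains no independent subset of cardinality $\lambda$. For a cardinal $\lambda$ consider the following statements. * $(\mathrm A)_\lambda$: there is a subalgebra of $\mathcal B(\lambda)$ of cardinality $\lambda$ and of dimension $\lambda$ with no independent subset of cardinality $\lambda$. * $(\mathrm T)_\lambda$: there is a zero-dimensional compact Hausdorff space $X$ with a regular Borel probability measure of dimension $\lambda$, whose measure algebra is moreover isomorphic (as a measure algebra) to $\mathcal B(\lambda)$, such that there is no continuous surjection from $X$ onto $\{0,1\}^{\lambda}$. **Theorem.** 1. Let $\mu$ be a singular strong limit cardinal of countable cofinality, i.e. a strong limit cardinal with $\mu>\mathrm{cf}(\mu)=\aleph_0$, and let $\lambda=\mu^+=2^\mu$. Then there is a strongly $\lambda$-anti-independent sequence $\langle(a_\alpha,b_\alpha):\alpha<\lambda\rangle$ in $\mathcal B(\mu)$ with $a_\alpha<b_\alpha$ for all $\alpha<\lambda$. Moreover $(\mathrm A)_\lambda$ and $(\mathrm T)_\lambda$ hold. 2. Let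 $\lambda$ be a regular uncountable cardinal and let $\langle(a_\alpha,b_\alpha):\alpha<\lambda\rangle$ be a sequence of pairs from $\mathcal B(\lambda)$ with $a_\alpha<b_\alpha$ for all $\alpha$, which is strongly, or just mediumly, $\lambda$-anti-independent. Then $(\mathrm A)_\lambda$ and $(\mathrm T)_\lambda$ hold. Moreover, the subalgebra in $(\mathrm A)_\lambda$ can be chosen isomorphic, as a Boolean algebra, to the subalgebra generated by $\{x_\alpha:\alpha<\lambda\}$ in the free extension of $\mathcal B(\lambda)$ for the sequence. -/

import Mathlib

open Set MeasureTheory Cardinal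
open scoped symmDiff ENNReal

universe u

/-! ### Measure algebras -/

/-- Two measurable sets are identified when they differ by a null set. -/
def MeasureAlgebra.setoid {Ω : Type u} [MeasurableSpace Ω] (m : Measure Ω) :
    Setoid {s : Set Ω // MeasurableSet s} where
  r s t := (s : Set Ω) =ᵐ[m] (t : Set Ω)
  iseqv := ⟨fun _ => Filter.EventuallyEq.rfl, fun h => h.symm, fun h h' => h.trans h'⟩

/-- The measure algebra of `m`: measurable sets modulo `m`-null sets. -/
def MeasureAlgebra {Ω : Type u} [MeasurableSpace Ω] (m : Measure Ω) : Type u :=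
  Quotient (MeasureAlgebra.setoid m)

namespace MeasureAlgebra

variable {Ω : Type u} [MeasurableSpace Ω] {m : Measure Ω}

/-- The class of a measurable set. -/
def mk (m : Measure Ω) (s : {s : Set Ω // MeasurableSet s}) : MeasureAlgebra m :=
  Quotient.mk (MeasureAlgebra.setoid m) s

theorem ind {p : MeasureAlgebra m → Prop} (h : ∀ s, p (mk m s)) (a : MeasureAlgebra m) : p a :=
  Quotient.inductionOn a h

theorem mk_eq_mk {s t : {s : Set Ω // MeasurableSet s}} :
    mk m s = mk m t ↔ (s : Set Ω) =ᵐ[m] (t : Set Ω) :=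
  Quotient.eq (r := MeasureAlgebra.setoid m)

/-- The Boolean operations are those of sets; `a ≤ b` is inclusion up to a null set. -/
noncomputable instance : BooleanAlgebra (MeasureAlgebra m) where
  le := Quotient.lift₂ (fun s t => (s : Set Ω) ≤ᵐ[m] (t : Set Ω))
    (fun _ _ _ _ h h' => propext
      ⟨fun hle => (h.symm.le.trans hle).trans h'.le, fun hle => (h.le.trans hle).trans h'.symm.le⟩)
  sup := Quotient.map₂ (fun s t => ⟨s ∪ t, s.2.union t.2⟩)
    (fun _ _ h _ _ h' => Filter.EventuallyEq.union h h')
  inf := Quotient.map₂ (fun s t => ⟨s ∩ t, s.2.inter t.2⟩)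
    (fun _ _ h _ _ h' => Filter.EventuallyEq.inter h h')
  compl := Quotient.map (fun s => ⟨sᶜ, s.2.compl⟩)
    (fun _ _ h => Filter.EventuallyEq.compl h)
  top := mk m ⟨univ, MeasurableSet.univ⟩
  bot := mk m ⟨∅, MeasurableSet.empty⟩
  le_refl := ind fun s => Filter.EventuallyLE.refl _ (s : Set Ω)
  le_trans := ind fun _ => ind fun _ => ind fun _ => fun h h' => Filter.EventuallyLE.trans h h'
  le_antisymm := ind fun _ => ind fun _ => fun h h' => mk_eq_mk.2 (Filter.EventuallyLE.antisymm h h')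
  le_sup_left := ind fun _ => ind fun _ => Filter.Eventually.of_forall fun _ h => Or.inl h
  le_sup_right := ind fun _ => ind fun _ => Filter.Eventually.of_forall fun _ h => Or.inr h
  sup_le := ind fun _ => ind fun _ => ind fun _ => fun h h' => by
    filter_upwards [h, h'] with x hx hx' using fun hh => hh.elim hx hx'
  inf_le_left := ind fun _ => ind fun _ => Filter.Eventually.of_forall fun _ h => h.1
  inf_le_right := ind fun _ => ind fun _ => Filter.Eventually.of_forall fun _ h => h.2
  le_inf := ind fun _ => ind fun _ => ind fun _ => fun h h' => by
    filter_upwards [h, h'] with x hx hx' using fun hh => ⟨hx hh, hx' hh⟩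
  le_sup_inf := ind fun _ => ind fun _ => ind fun _ =>
    Filter.Eventually.of_forall fun _ h =>
      h.1.elim Or.inl fun hy => h.2.elim Or.inl fun hz => Or.inr ⟨hy, hz⟩
  inf_compl_le_bot := ind fun _ => Filter.Eventually.of_forall fun _ h => h.2 h.1
  top_le_sup_compl := ind fun s => Filter.Eventually.of_forall fun x _ => em (x ∈ (s : Set Ω))
  le_top := ind fun _ => Filter.Eventually.of_forall fun _ _ => trivial
  bot_le := ind fun _ => Filter.Eventually.of_forall fun _ h => False.elim h

/-- The measure of an element of the measure algebra. -/
noncomputable def leb : MeasureAlgebra m → ℝ≥0∞ :=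
  Quotient.lift (fun s : {s : Set Ω // MeasurableSet s} => m (s : Set Ω))
    (fun _ _ h => measure_congr h)

/-- The closure of a set in the metric `leb (a ∆ b)`.  The metric closure of a Boolean subalgebra
is the complete subalgebra that it generates (for finite `m`). -/
def metricClosure (T : Set (MeasureAlgebra m)) : Set (MeasureAlgebra m) :=
  {b | ∀ ε : ℝ≥0∞, 0 < ε → ∃ t ∈ T, leb (b ∆ t) < ε}

/-- The (Maharam) dimension, or Maharam type, of a Boolean subalgebra `S` of a measure algebra:
the least cardinality of a set that completely generates the same complete subalgebra as `S`. -/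
noncomputable def dimension (S : BooleanSubalgebra (MeasureAlgebra m)) : Cardinal.{u} :=
  sInf {c | ∃ D : Set (MeasureAlgebra m), D ⊆ metricClosure (S : Set (MeasureAlgebra m)) ∧
    (S : Set (MeasureAlgebra m)) ⊆
      metricClosure (BooleanSubalgebra.closure D : Set (MeasureAlgebra m)) ∧ #D = c}

end MeasureAlgebra

/-- The fair coin-tossing measure on `{0,1}^I`. -/
noncomputable def coinMeasure (I : Type u) : Measure (I → Bool) :=
  Measure.infinitePi fun _ => (PMF.uniformOfFintype Bool).toMeasure

/-- The Maharam measure algebra of dimension `#I`: its free generators are the classes of the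
sets `{x | x i = true}`. -/
abbrev MaharamAlgebra (I : Type u) : Type u := MeasureAlgebra (coinMeasure I)

/-! ### Independence in Boolean algebras -/

/-- A subset of a Boolean algebra is independent (free) if no nontrivial Boolean combination of
finitely many of its members vanishes. -/
def IsIndependent {B : Type u} [BooleanAlgebra B] (I : Set B) : Prop :=
  ∀ F G : Finset B, (F : Set B) ⊆ I → (G : Set B) ⊆ I → Disjoint F G →
    F.inf id ⊓ G.inf compl ≠ ⊥

/-- The set `T` contains no independent subset of cardinality `c`. -/
def NoIndependentSubset {B : Type u} [BooleanAlgebra B] (c : Cardinal.{u}) (T : Set B) : Prop :=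
  ¬ ∃ I : Set B, I ⊆ T ∧ IsIndependent I ∧ #I = c

/-- The family of intervals `(a i, b i)` in `B` is strongly `c`-anti-independent: whenever one
chooses elements `x i` of these intervals, for `c` many `i`, in a Boolean algebra `B'` extending
`B`, the subalgebra that they generate contains no independent subset of cardinality `c`. -/
def StronglyAntiIndependent {B I : Type u} [BooleanAlgebra B] (c : Cardinal.{u})
    (a b : I → B) : Prop :=
  (∀ i, a i ≤ b i) ∧
  ∀ (B' : Type u) [BooleanAlgebra B'] (f : BoundedLatticeHom B B'), Function.Injective f →
    ∀ X : Set I, #X = c → ∀ x : I → B', (∀ i ∈ X, f (a i) ≤ x i ∧ x i ≤ f (b i)) →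
      NoIndependentSubset c (BooleanSubalgebra.closure (x '' X) : Set B')

/-- `B'`, with `f : B → B'` and the elements `x i`, is the Boolean algebra freely generated by
`B` and elements `x i` subject to the equations of `B` and to `a i ≤ x i ≤ b i`. -/
def IsFreeExtension {B I : Type u} [BooleanAlgebra B] (a b : I → B)
    {B' : Type u} [BooleanAlgebra B'] (f : BoundedLatticeHom B B') (x : I → B') : Prop :=
  (∀ i, f (a i) ≤ x i ∧ x i ≤ f (b i)) ∧
  ∀ (C : Type u) [BooleanAlgebra C] (g : BoundedLatticeHom B C) (y : I → C),
    (∀ i, g (a i) ≤ y i ∧ y i ≤ g (b i)) →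
      ∃! h : BoundedLatticeHom B' C, (∀ p, h (f p) = g p) ∧ ∀ i, h (x i) = y i

/-- The family of intervals `(a i, b i)` in `B` is mediumly `c`-anti-independent: in the free
extension of `B` by elements `x i` of these intervals, the subalgebra generated by the `x i`
contains no independent subset of cardinality `c`. -/
def MediumlyAntiIndependent {B I : Type u} [BooleanAlgebra B] (c : Cardinal.{u})
    (a b : I → B) : Prop :=
  (∀ i, a i ≤ b i) ∧
  ∀ (B' : Type u) [BooleanAlgebra B'] (f : BoundedLatticeHom B B') (x : I → B'),
    IsFreeExtension a b f x →
      NoIndependentSubset c (BooleanSubalgebra.closure (range x) : Set B')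

/-! ### The two forms of the conclusion -/

/-- `S` is a subalgebra of the Maharam algebra of dimension `#L` which has cardinality and
dimension `#L`, but no independent subset of cardinality `#L`. -/
def IsLargeWithoutIndependent {L : Type u} (S : BooleanSubalgebra (MaharamAlgebra L)) : Prop :=
  #S = #L ∧ MeasureAlgebra.dimension S = #L ∧
    NoIndependentSubset #L (S : Set (MaharamAlgebra L))

/-- There is a zero-dimensional compact Hausdorff space with a regular Borel probability measure
of dimension `#L`, even with measure algebra isomorphic to the Maharam algebra of dimension `#L`,
which has no continuous map onto `{0,1}^L`. -/
def ExistsSpaceNotOntoCube (L : Type u) : Prop :=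
  ∃ (X : Type u) (_ : TopologicalSpace X) (_ : MeasurableSpace X) (_ : BorelSpace X)
    (m : Measure X),
    CompactSpace X ∧ T2Space X ∧ TopologicalSpace.IsTopologicalBasis {s : Set X | IsClopen s} ∧
    IsProbabilityMeasure m ∧ m.Regular ∧
    MeasureAlgebra.dimension (⊤ : BooleanSubalgebra (MeasureAlgebra m)) = #L ∧
    (∃ e : MeasureAlgebra m ≃o MaharamAlgebra L,
      ∀ a, MeasureAlgebra.leb (e a) = MeasureAlgebra.leb a) ∧
    ¬ ∃ φ : X → (L → Bool), Continuous φ ∧ Function.Surjective φ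

/-!
The two halves of the argument are the construction of an anti-independent sequence and its
conversion into an algebra and a space.

*Construction.*  Let `#M` be a strong limit of countable cofinality.  A set of fewer than `#M`
points of `{0,1}^M` takes fewer than `#M` patterns along the coordinates, so its members are all
constant on a common infinite set of coordinates; hence a set of at most `#M` points is covered by
an open set of measure less than one (`exists_isOpen_coinMeasure_lt_one`).  Enumerate the cube in
order type `(#M)⁺ = 2 ^ #M` and let `c i` be the complement of such a cover of the points with
index at most `i`.  The sets `c i` are closed and not null, and each point lies in at most `#M` of
them.  The intervals `(⊥, c i)` are strongly anti-independent: an ultrafilter of an extension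
selects, by compactness, a point `z` lying in all the `c i` that it contains, so that its trace on
the `x i` is given by `z` and a set of indices `i` with `z ∈ c i`.  This leaves `2 ^ #M` traces,
whereas an independent set of size `#L` would need `2 ^ #L` of them
(`noIndependentSubset_of_card_lt`, `stronglyAntiIndependent_of_isClosed`).

*The algebra.*  Split the coordinates in two halves.  Place the intervals in the algebra of the
first half and fill the interval `(a i, b i)` by `a i ⊔ (b i ⊓ γ i)`, where the `γ i` are the free
generators of the second half.  By the universal property these elements generate, together with
the first half, the free extension (`IsFreeOver.isFreeExtension`), so medium anti-independence
forbids large independent sets in the subalgebra that they generate.  Flipping the coin `γ i` shows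
that the elements whose interval has measure at least `ε` are `ε / 2`-separated, which determines
the dimension (`leb_sdiff_le_leb_symmDiff_intervalElement`).

*The space.*  The Stone space of that subalgebra need not carry a measure algebra isomorphic to the
full Maharam algebra.  Since `#L` is regular, there are a non-null event `E` and `#L` disjoint
countable blocks of intervals such that almost every point of `E` lies in infinitely many sets
`b i \ a i` of each block (`exists_blocks`).  Conditionally on `E` each block of filled intervals is
then a random element of `{0,1}^ℕ` with diffuse law given the earlier blocks
(`isConditionallyDiffuse_encodeBlocks`); transforming it by its conditional distribution function
produces independent uniform variables, from which the blocks are recovered by induction along a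
well-order (`map_chainTransform`, `exists_ae_eq_chainTransform_preimage`).  Hence the joint law has
the measure algebra of `#L` coins.  The space is the support of this law in the cube, with the
regular Borel extension given by the Riesz representation theorem.  A continuous surjection onto
`{0,1}^L` would pull the coordinates back to an independent set in the subalgebra
(`not_exists_continuous_surjective_cubeSupport`).
-/

/-! ### Truth assignments and independence in Boolean algebras -/

/-- A truth assignment on a Boolean algebra: the membership predicate of an ultrafilter,
equivalently a homomorphism onto the two-element algebra. -/
structure IsTruthAssignment {A : Type u} [BooleanAlgebra A] (t : A → Prop) : Prop where
  inf : ∀ a b, t (a ⊓ b) ↔ t a ∧ t b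
  compl : ∀ a, t aᶜ ↔ ¬ t a

namespace IsTruthAssignment

variable {A B : Type u} [BooleanAlgebra A] [BooleanAlgebra B] {t : A → Prop}

theorem bot (h : IsTruthAssignment t) : ¬ t ⊥ := fun hb => by
  have h1 := (h.inf ⊥ ⊥ᶜ).1 (by simpa using hb)
  exact (h.compl ⊥).1 h1.2 h1.1

theorem top (h : IsTruthAssignment t) : t ⊤ := by
  rw [← compl_bot, h.compl]; exact h.bot

theorem sup (h : IsTruthAssignment t) (a b : A) : t (a ⊔ b) ↔ t a ∨ t b := by
  rw [← compl_compl (a ⊔ b), h.compl, compl_sup, h.inf, h.compl, h.compl]; tauto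

theorem mono (h : IsTruthAssignment t) {a b : A} (hab : a ≤ b) (ha : t a) : t b := by
  rw [← inf_eq_left.2 hab] at ha
  exact ((h.inf _ _).1 ha).2

theorem finset_inf (h : IsTruthAssignment t) {ι : Type*} (F : Finset ι) (k : ι → A) :
    t (F.inf k) ↔ ∀ i ∈ F, t (k i) := by
  classical
  induction F using Finset.induction_on with
  | empty => simp [h.top]
  | insert i F _ ih => simp [Finset.inf_insert, h.inf, ih]

theorem comp (h : IsTruthAssignment t) (f : BoundedLatticeHom B A) :
    IsTruthAssignment fun b => t (f b) :=
  ⟨fun a b => by rw [map_inf, h.inf], fun a => by rw [map_compl', h.compl]⟩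

/-- Truth assignments that agree on a set agree on the subalgebra that it generates. -/
theorem eq_on_closure (h : IsTruthAssignment t) {t' : A → Prop} (h' : IsTruthAssignment t')
    {s : Set A} (hs : ∀ a ∈ s, t a ↔ t' a) {a : A} (ha : a ∈ BooleanSubalgebra.closure s) :
    t a ↔ t' a := by
  induction ha using BooleanSubalgebra.closure_bot_sup_induction with
  | mem x hx => exact hs x hx
  | bot => simp [h.bot, h'.bot]
  | sup x _ y _ hx hy => rw [h.sup, h'.sup, hx, hy]
  | compl x _ hx => rw [h.compl, h'.compl, hx]

/-- The Boolean prime ideal theorem: a set with the finite intersection property is contained in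
an ultrafilter. -/
theorem exists_of_finset_inf_ne_bot {S : Set A}
    (hS : ∀ F : Finset A, (F : Set A) ⊆ S → F.inf id ≠ ⊥) :
    ∃ t : A → Prop, IsTruthAssignment t ∧ ∀ a ∈ S, t a := by
  classical
  have hF : Order.IsPFilter {a : A | ∃ F : Finset A, (F : Set A) ⊆ S ∧ F.inf id ≤ a} := by
    refine Order.IsPFilter.of_def ⟨⊤, ∅, by simp, le_top⟩ ?_ ?_
    · rintro a ⟨F, hF, ha⟩ b ⟨G, hG, hb⟩
      refine ⟨(F ∪ G).inf id, ⟨F ∪ G, by simp [hF, hG], le_rfl⟩, ?_, ?_⟩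
      · exact (Finset.inf_mono Finset.subset_union_left).trans ha
      · exact (Finset.inf_mono Finset.subset_union_right).trans hb
    · rintro a b hab ⟨F, hF, ha⟩
      exact ⟨F, hF, ha.trans hab⟩
  obtain ⟨J, hJ, -, hd⟩ := DistribLattice.prime_ideal_of_disjoint_filter_ideal
    (F := hF.toPFilter) (I := (⊥ : Order.Ideal A)) (by
      rw [Set.disjoint_left]
      rintro a ⟨F, hF, ha⟩ hb
      have hb' : a = ⊥ := le_bot_iff.1 hb
      exact hS F hF (le_bot_iff.1 (hb' ▸ ha)))
  refine ⟨fun a => a ∉ J, ⟨fun a b => ?_, fun a => ?_⟩, fun a ha hJa => ?_⟩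
  · constructor
    · exact fun h => ⟨fun h' => h (J.lower inf_le_left h'), fun h' => h (J.lower inf_le_right h')⟩
    · rintro ⟨ha, hb⟩ h
      exact (hJ.mem_or_mem h).elim ha hb
  · constructor
    · exact fun h h' => (hJ.mem_or_compl_mem (x := a)).elim h' h
    · intro h h'
      have : a ⊔ aᶜ ∈ J := Order.Ideal.sup_mem (not_not.1 h) h'
      rw [sup_compl_eq_top] at this
      exact hJ.toIsProper.top_notMem this
  · exact Set.disjoint_left.1 hd ⟨{a}, by simpa using ha, by simp⟩ hJa

theorem exists_of_ne_bot {a : A} (ha : a ≠ ⊥) : ∃ t : A → Prop, IsTruthAssignment t ∧ t a := by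
  obtain ⟨t, ht, h⟩ := exists_of_finset_inf_ne_bot (S := {a}) fun F hF => by
    intro h0
    refine ha (le_bot_iff.1 (h0 ▸ Finset.le_inf fun b hb => ?_))
    rw [Set.mem_singleton_iff.1 (hF hb), id]
  exact ⟨t, ht, h a rfl⟩

end IsTruthAssignment

section Independence

variable {A B : Type u} [BooleanAlgebra A] [BooleanAlgebra B]

/-- On an independent set a truth assignment can be prescribed arbitrarily. -/
theorem IsIndependent.exists_truthAssignment {I : Set A} (hI : IsIndependent I) (J : Set A) :
    ∃ t : A → Prop, IsTruthAssignment t ∧ ∀ a ∈ I, t a ↔ a ∈ J := by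
  classical
  obtain ⟨t, ht, h⟩ := IsTruthAssignment.exists_of_finset_inf_ne_bot
    (S := (I ∩ J) ∪ compl '' (I \ J)) fun F hF h0 => by
      refine hI (F.filter (· ∈ I ∩ J)) ((F.filter (· ∉ I ∩ J)).image compl) ?_ ?_ ?_ ?_
      · intro a ha
        exact (Finset.mem_filter.1 ha).2.1
      · intro a ha
        obtain ⟨b, hb, rfl⟩ := Finset.mem_image.1 ha
        obtain ⟨hb, hb'⟩ := Finset.mem_filter.1 hb
        obtain ⟨c, hc, rfl⟩ := (hF hb).resolve_left hb'
        simpa using hc.1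
      · rw [Finset.disjoint_left]
        intro a ha ha'
        obtain ⟨b, hb, rfl⟩ := Finset.mem_image.1 ha'
        obtain ⟨hb, hb'⟩ := Finset.mem_filter.1 hb
        obtain ⟨c, hc, rfl⟩ := (hF hb).resolve_left hb'
        exact hc.2 (by simpa using (Finset.mem_filter.1 ha).2.2)
      · rw [← le_bot_iff, ← h0]
        refine Finset.le_inf fun a ha => ?_
        by_cases haJ : a ∈ I ∩ J
        · exact inf_le_left.trans (Finset.inf_le (f := id) (Finset.mem_filter.2 ⟨ha, haJ⟩))
        · refine inf_le_right.trans ?_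
          have := Finset.inf_le (f := compl) (Finset.mem_image_of_mem compl
            ((Finset.mem_filter (p := (· ∉ I ∩ J))).2 ⟨ha, haJ⟩))
          simpa using this
  refine ⟨t, ht, fun a ha => ⟨fun h1 => ?_, fun h1 => h a (Or.inl ⟨ha, h1⟩)⟩⟩
  by_contra h2
  exact (ht.compl a).1 (h _ (Or.inr ⟨a, ⟨ha, h2⟩, rfl⟩)) h1

theorem isIndependent_range {ι : Type u} {k : ι → A}
    (h : ∀ F G : Finset ι, Disjoint F G → F.inf k ⊓ G.inf (fun i => (k i)ᶜ) ≠ ⊥) :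
    IsIndependent (range k) := by
  classical
  intro F G hF hG hFG
  rw [← image_univ] at hF hG
  obtain ⟨F', -, rfl⟩ := Finset.subset_set_image_iff.1 hF
  obtain ⟨G', -, rfl⟩ := Finset.subset_set_image_iff.1 hG
  rw [Finset.inf_image, Finset.inf_image]
  refine h F' G' (Finset.disjoint_left.2 fun i hi hi' => ?_)
  exact Finset.disjoint_left.1 hFG (Finset.mem_image_of_mem k hi) (Finset.mem_image_of_mem k hi')

theorem injective_of_inf_ne_bot {ι : Type u} {k : ι → A}
    (h : ∀ F G : Finset ι, Disjoint F G → F.inf k ⊓ G.inf (fun i => (k i)ᶜ) ≠ ⊥) :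
    Function.Injective k := by
  intro i j hij
  by_contra hne
  exact h {i} {j} (by simpa using hne) (by simp [hij])

theorem IsIndependent.of_image {f : BoundedLatticeHom A B} (hf : Function.Injective f)
    {I : Set A} (hI : IsIndependent (f '' I)) : IsIndependent I := by
  classical
  intro F G hF hG hFG h0
  refine hI (F.image f) (G.image f) ?_ ?_ ?_ ?_
  · rw [Finset.coe_image]; exact image_mono hF
  · rw [Finset.coe_image]; exact image_mono hG
  · exact (Finset.disjoint_image hf).2 hFG
  · have := congrArg f h0
    rw [map_inf, map_finset_inf, map_finset_inf, map_bot] at this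
    rw [Finset.inf_image, Finset.inf_image, ← this]
    congr 1
    exact Finset.inf_congr rfl fun a _ => (map_compl' f a).symm

/-- An independent set of size `c` in the subalgebra generated by `s` yields `2 ^ c` truth
assignments with different traces on `s`.  So there is none if all these traces occur in a family
`ρ` of fewer than `2 ^ c` subsets. -/
theorem noIndependentSubset_of_card_lt {c : Cardinal.{u}} {s : Set A} {R : Type u}
    (ρ : R → A → Prop) (hR : #R < 2 ^ c)
    (h : ∀ t : A → Prop, IsTruthAssignment t → ∃ r, ∀ a ∈ s, t a ↔ ρ r a) :
    NoIndependentSubset c (BooleanSubalgebra.closure s : Set A) := by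
  rintro ⟨I, hIs, hI, rfl⟩
  choose t ht htI using fun J : Set I => hI.exists_truthAssignment (Subtype.val '' J)
  choose r hr using fun J => h (t J) (ht J)
  refine hR.not_ge ?_
  rw [← mk_set]
  refine mk_le_of_injective (f := r) fun J J' hJ => ?_
  ext ⟨a, ha⟩
  have key : ∀ K : Set I, t K a ↔ ⟨a, ha⟩ ∈ K := fun K => by
    rw [htI K a ha]; simp [ha]
  rw [← key, ← key]
  refine (ht J).eq_on_closure (ht J') (fun b hb => ?_) (hIs ha)
  rw [hr J b hb, hr J' b hb, hJ]

end Independence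

namespace BooleanSubalgebra

theorem card_closure_le {A : Type u} [BooleanAlgebra A] (D : Set A) :
    #(closure D) ≤ max #D ℵ₀ := by
  -- the elements obtained from `D` and `⊥` in at most `n` rounds of Boolean operations
  let T : ℕ → Set A := Nat.rec (insert ⊥ D)
    (fun _ T => T ∪ (compl '' T ∪ image2 (· ⊔ ·) T T))
  have hT : ∀ n, T (n + 1) = T n ∪ (compl '' T n ∪ image2 (· ⊔ ·) (T n) (T n)) := fun _ => rfl
  have mono : Monotone T := monotone_nat_of_le_succ fun n => by rw [hT]; exact subset_union_left
  have card : ∀ n, #↥(T n) ≤ max #D ℵ₀ := by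
    have h0 : ℵ₀ ≤ max #D ℵ₀ := le_max_right _ _
    intro n
    induction n with
    | zero =>
      exact (mk_insert_le).trans
        (add_le_of_le h0 (le_max_left _ _) (one_le_aleph0.trans h0))
    | succ n ih =>
      rw [hT]
      refine (mk_union_le _ _).trans (add_le_of_le h0 ih ((mk_union_le _ _).trans
        (add_le_of_le h0 (mk_image_le.trans ih) ?_)))
      exact mk_image2_le.trans (mul_le_of_le h0 ih ih)
  have sub : (closure D : Set A) ⊆ ⋃ n, T n := by
    intro a ha
    have ha' : a ∈ closure D := ha
    induction ha' using closure_bot_sup_induction with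
    | mem x hx => exact mem_iUnion.2 ⟨0, Or.inr hx⟩
    | bot => exact mem_iUnion.2 ⟨0, Or.inl rfl⟩
    | sup x hx y hy h1 h2 =>
      obtain ⟨n, hn⟩ := mem_iUnion.1 (h1 hx)
      obtain ⟨m, hm⟩ := mem_iUnion.1 (h2 hy)
      refine mem_iUnion.2 ⟨max n m + 1, ?_⟩
      rw [hT]
      exact Or.inr (Or.inr ⟨x, mono (le_max_left _ _) hn, y, mono (le_max_right _ _) hm, rfl⟩)
    | compl x hx h1 =>
      obtain ⟨n, hn⟩ := mem_iUnion.1 (h1 hx)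
      refine mem_iUnion.2 ⟨n + 1, ?_⟩
      rw [hT]
      exact Or.inr (Or.inl ⟨x, hn, rfl⟩)
  calc #(closure D) ≤ #(⋃ n, T n) := mk_le_mk_of_subset sub
    _ ≤ max #D ℵ₀ := by
      have h := mk_iUnion_le_lift T
      simp only [mk_nat, lift_aleph0, lift_uzero] at h
      refine h.trans ?_
      refine mul_le_of_le (le_max_right _ _) (le_max_right _ _) (ciSup_le' fun n => ?_)
      simpa using card n

/-- An injective homomorphism maps the subalgebra generated by `s` isomorphically onto the one
generated by the image of `s`. -/
theorem nonempty_closure_image_orderIso {A B : Type u} [BooleanAlgebra A] [BooleanAlgebra B]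
    {f : BoundedLatticeHom A B} (hf : Function.Injective f) (s : Set A) :
    Nonempty (closure (f '' s) ≃o closure s) := by
  have himg : (closure (f '' s) : Set B) = f '' (closure s : Set A) := by
    refine Subset.antisymm ?_ ?_
    · have : closure (f '' s) ≤ (closure s).map f :=
        closure_le.2 (image_mono subset_closure)
      exact this
    · have : closure s ≤ (closure (f '' s)).comap f :=
        closure_le.2 fun a ha => subset_closure (mem_image_of_mem f ha)
      exact image_subset_iff.2 this
  have hmem : ∀ a : closure s, f a ∈ closure (f '' s) := fun a => by
    rw [← SetLike.mem_coe, himg]; exact mem_image_of_mem f a.2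
  have hle : ∀ a b : A, f a ≤ f b ↔ a ≤ b := fun a b => by
    rw [← inf_eq_left, ← InfHomClass.map_inf, hf.eq_iff, inf_eq_left]
  let g : closure s ≃ closure (f '' s) := Equiv.ofBijective (fun a => ⟨f a, hmem a⟩) <| by
    refine ⟨fun a b hab => Subtype.ext (hf (congrArg Subtype.val hab)), fun ⟨b, hb⟩ => ?_⟩
    rw [← SetLike.mem_coe, himg] at hb
    obtain ⟨a, ha, rfl⟩ := hb
    exact ⟨⟨a, ha⟩, rfl⟩
  exact ⟨OrderIso.symm ⟨g, fun {a b} => hle a b⟩⟩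

end BooleanSubalgebra

/-! ### Measure algebras: the metric, pullbacks, and the dimension -/

namespace MeasureAlgebra

variable {Ω Ω' : Type u} [MeasurableSpace Ω] [MeasurableSpace Ω'] {m : Measure Ω}
  {m' : Measure Ω'}

theorem mk_le_mk_of_subset {s t : {s : Set Ω // MeasurableSet s}} (h : (s : Set Ω) ⊆ t) :
    mk m s ≤ mk m t :=
  Filter.Eventually.of_forall fun _ hx => h hx

theorem leb_eq_zero {a : MeasureAlgebra m} : leb a = 0 ↔ a = ⊥ := by
  induction a using ind with
  | h s =>
    exact (ae_eq_empty (μ := m)).symm.trans (mk_eq_mk (t := ⟨∅, MeasurableSet.empty⟩)).symm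

theorem leb_bot : leb (⊥ : MeasureAlgebra m) = 0 := leb_eq_zero.2 rfl

theorem leb_mono {a b : MeasureAlgebra m} (h : a ≤ b) : leb a ≤ leb b := by
  induction a using ind with
  | h s => induction b using ind with
    | h t => exact measure_mono_ae h

theorem leb_sup_le (a b : MeasureAlgebra m) : leb (a ⊔ b) ≤ leb a + leb b := by
  induction a using ind with
  | h s => induction b using ind with
    | h t => exact measure_union_le _ _

theorem leb_symmDiff_le (a b c : MeasureAlgebra m) :
    leb (a ∆ c) ≤ leb (a ∆ b) + leb (b ∆ c) :=
  (leb_mono (symmDiff_triangle a b c)).trans (leb_sup_le _ _)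

theorem subset_metricClosure (T : Set (MeasureAlgebra m)) : T ⊆ metricClosure T :=
  fun t ht ε hε => ⟨t, ht, by rwa [symmDiff_self, leb_bot]⟩

/-- Taking preimages under a measure-preserving map, as a homomorphism of measure algebras. -/
def pullback {f : Ω → Ω'} (hf : MeasurePreserving f m m') :
    BoundedLatticeHom (MeasureAlgebra m') (MeasureAlgebra m) where
  toFun := Quotient.map (fun s => ⟨f ⁻¹' s, hf.measurable s.2⟩)
    fun _ _ h => hf.quasiMeasurePreserving.preimage_ae_eq h
  map_sup' := ind fun _ => ind fun _ => rfl
  map_inf' := ind fun _ => ind fun _ => rfl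
  map_top' := rfl
  map_bot' := rfl

theorem leb_pullback {f : Ω → Ω'} (hf : MeasurePreserving f m m') (a : MeasureAlgebra m') :
    leb (pullback hf a) = leb a := by
  induction a using ind with
  | h s => exact hf.measure_preimage s.2.nullMeasurableSet

theorem pullback_injective {f : Ω → Ω'} (hf : MeasurePreserving f m m') :
    Function.Injective (pullback hf) := by
  intro a b hab
  rw [← symmDiff_eq_bot, ← leb_eq_zero, ← leb_pullback hf, map_symmDiff', hab, symmDiff_self,
    leb_bot]

/-- A measure-preserving map induces an isomorphism of measure algebras as soon as every
measurable set is, up to a null set, the preimage of a measurable set. -/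
theorem exists_orderIso_of_measurePreserving {f : Ω → Ω'} (hf : MeasurePreserving f m m')
    (h : ∀ s, MeasurableSet s → ∃ t, MeasurableSet t ∧ s =ᵐ[m] f ⁻¹' t) :
    ∃ e : MeasureAlgebra m' ≃o MeasureAlgebra m, ∀ a, leb (e a) = leb a := by
  have hs : Function.Surjective (pullback hf) := ind fun s => by
    obtain ⟨t, ht, hst⟩ := h s s.2
    exact ⟨mk m' ⟨t, ht⟩, mk_eq_mk.2 hst.symm⟩
  refine ⟨⟨Equiv.ofBijective _ ⟨pullback_injective hf, hs⟩, fun {a b} => ?_⟩, leb_pullback hf⟩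
  change pullback hf a ≤ pullback hf b ↔ a ≤ b
  rw [← inf_eq_left, ← map_inf, (pullback_injective hf).eq_iff, inf_eq_left]

/-- The dimension is `c` if there are a generating set of size at most `c` and a uniformly
separated family of size `c`. -/
theorem dimension_eq {S : BooleanSubalgebra (MeasureAlgebra m)} {c : Cardinal.{u}} (hc : ℵ₀ < c)
    {D : Set (MeasureAlgebra m)} (hD : D ⊆ metricClosure S)
    (hSD : (S : Set (MeasureAlgebra m)) ⊆ metricClosure (BooleanSubalgebra.closure D))
    (hDc : #D ≤ c) {ι : Type u} (hι : #ι = c) {x : ι → MeasureAlgebra m} (hx : ∀ i, x i ∈ S)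
    {ε : ℝ≥0∞} (hε : 0 < ε) (hsep : ∀ i j, i ≠ j → ε ≤ leb (x i ∆ x j)) : dimension S = c := by
  -- elements of `closure D'` that are `ε / 2`-close to different `x i` are different
  have lower : ∀ D' : Set (MeasureAlgebra m),
      (S : Set (MeasureAlgebra m)) ⊆ metricClosure (BooleanSubalgebra.closure D') → c ≤ #D' := by
    intro D' hD'
    choose t ht hxt using fun i => hD' (hx i) (ε / 2) (ENNReal.half_pos hε.ne')
    have hinj : Function.Injective fun i => (⟨t i, ht i⟩ : BooleanSubalgebra.closure D') := by
      intro i j hij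
      by_contra hne
      have hij' : t i = t j := congrArg Subtype.val hij
      refine (hsep i j hne).not_gt ((leb_symmDiff_le _ (t i) _).trans_lt ?_)
      rw [← ENNReal.add_halves ε, symmDiff_comm (t i), hij']
      exact ENNReal.add_lt_add (hij' ▸ hxt i) (hxt j)
    have h1 := (mk_le_of_injective hinj).trans (BooleanSubalgebra.card_closure_le D')
    rw [hι] at h1
    exact (le_max_iff.1 h1).resolve_right hc.not_ge
  refine le_antisymm ?_ ?_
  · exact le_trans (csInf_le' (a := #D) ⟨D, hD, hSD, rfl⟩) hDc
  · refine le_csInf ⟨_, D, hD, hSD, rfl⟩ ?_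
    rintro _ ⟨D', -, hD', rfl⟩
    exact lower D' hD'

/-- A generating family of sets generates a metrically dense subalgebra. -/
theorem mem_metricClosure_of_generateFrom [IsFiniteMeasure m] {𝒜 : Set (Set Ω)}
    (h𝒜 : ‹MeasurableSpace Ω› = MeasurableSpace.generateFrom 𝒜) {D : Set (MeasureAlgebra m)}
    (hD : ∀ s (hs : MeasurableSet s), s ∈ 𝒜 → mk m ⟨s, hs⟩ ∈ D) (a : MeasureAlgebra m) :
    a ∈ metricClosure (BooleanSubalgebra.closure D : Set (MeasureAlgebra m)) := by
  let 𝒞 : Set (Set Ω) := {s | ∃ hs : MeasurableSet s, mk m ⟨s, hs⟩ ∈ BooleanSubalgebra.closure D}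
  have h𝒞 : IsSetAlgebra 𝒞 :=
    { empty_mem := ⟨MeasurableSet.empty, BooleanSubalgebra.bot_mem⟩
      compl_mem := fun s ⟨hs, h⟩ => ⟨hs.compl, BooleanSubalgebra.compl_mem h⟩
      union_mem := fun s t ⟨hs, h⟩ ⟨ht, h'⟩ => ⟨hs.union ht, BooleanSubalgebra.sup_mem h h'⟩ }
  have hgen : ‹MeasurableSpace Ω› = MeasurableSpace.generateFrom 𝒞 := by
    refine le_antisymm ?_ (MeasurableSpace.generateFrom_le fun s hs => hs.1)
    conv_lhs => rw [h𝒜]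
    refine MeasurableSpace.generateFrom_mono fun s hs => ?_
    have hs' : MeasurableSet s := by rw [h𝒜]; exact MeasurableSpace.measurableSet_generateFrom hs
    exact ⟨hs', BooleanSubalgebra.subset_closure (hD s hs' hs)⟩
  have dense := Measure.MeasureDense.of_generateFrom_isSetAlgebra_finite m h𝒞 hgen
  induction a using ind with
  | h s =>
    intro ε hε
    obtain ⟨δ, -, hδ, hδε⟩ := ENNReal.lt_iff_exists_real_btwn.1 hε
    obtain ⟨t, ⟨ht, htD⟩, hst⟩ := dense.approx s s.2 (measure_ne_top _ _) δ
      (ENNReal.ofReal_pos.1 hδ)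
    exact ⟨_, htD, hst.trans hδε⟩

end MeasureAlgebra

/-! ### The coin-tossing measure -/

instance coinMeasure.isProbabilityMeasure (I : Type u) : IsProbabilityMeasure (coinMeasure I) := by
  unfold coinMeasure; infer_instance

theorem measurePreserving_coinMeasure_comp {I J : Type u} {j : I → J} (hj : Function.Injective j) :
    MeasurePreserving (fun (x : J → Bool) i => x (j i)) (coinMeasure J) (coinMeasure I) :=
  ⟨by fun_prop, Measure.map_infinitePi_infinitePi_of_inj hj⟩

/-- Events about disjoint sets of coins are independent. -/
theorem indep_coinMeasure {I : Type u} {S T : Set I} (h : Disjoint S T) :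
    ProbabilityTheory.Indep
      (⨆ i ∈ S, MeasurableSpace.comap (fun x : I → Bool => x i) inferInstance)
      (⨆ i ∈ T, MeasurableSpace.comap (fun x : I → Bool => x i) inferInstance)
      (coinMeasure I) := by
  have hind : ProbabilityTheory.iIndepFun (fun i (x : I → Bool) => x i) (coinMeasure I) :=
    ProbabilityTheory.iIndepFun_infinitePi (X := fun _ b => b) (by fun_prop)
  exact ProbabilityTheory.indep_iSup_of_disjoint (fun i => (measurable_pi_apply i).comap_le)
    hind.iIndep h

theorem measurable_comp_iSup_comap {I K : Type u} {T : Set I} {j : K → I} (hj : ∀ k, j k ∈ T) :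
    Measurable[⨆ i ∈ T, MeasurableSpace.comap (fun x : I → Bool => x i) inferInstance]
      (fun (x : I → Bool) k => x (j k)) := by
  refine @measurable_pi_lambda _ _ _ (_) _ _ fun k => ?_
  exact (comap_measurable _).mono (le_iSup₂ (f := fun i (_ : i ∈ T) =>
      MeasurableSpace.comap (fun x : I → Bool => x i) inferInstance) (j k) (hj k)) le_rfl

/-- Two disjoint sets of coordinates give a map onto a product of cubes. -/
theorem measurePreserving_coinMeasure_prod {I J K : Type u} {j₁ : J → I} {j₂ : K → I}
    (h₁ : Function.Injective j₁) (h₂ : Function.Injective j₂) (hd : ∀ i k, j₁ i ≠ j₂ k) :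
    MeasurePreserving (fun (x : I → Bool) => ((fun i => x (j₁ i), fun k => x (j₂ k)) :
      (J → Bool) × (K → Bool))) (coinMeasure I) ((coinMeasure J).prod (coinMeasure K)) := by
  have hp₁ := measurePreserving_coinMeasure_comp h₁
  have hp₂ := measurePreserving_coinMeasure_comp h₂
  refine ⟨hp₁.measurable.prodMk hp₂.measurable, ?_⟩
  rw [← hp₁.map_eq, ← hp₂.map_eq]
  refine (ProbabilityTheory.indepFun_iff_map_prod_eq_prod_map_map hp₁.measurable.aemeasurable
    hp₂.measurable.aemeasurable).1 ?_
  have hdisj : Disjoint (range j₁) (range j₂) := by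
    rw [Set.disjoint_left]
    rintro _ ⟨i, rfl⟩ ⟨k, hk⟩
    exact hd i k hk.symm
  exact ProbabilityTheory.indep_of_indep_of_le_left
    (ProbabilityTheory.indep_of_indep_of_le_right (indep_coinMeasure hdisj)
      (measurable_comp_iSup_comap fun k => mem_range_self k).comap_le)
    (measurable_comp_iSup_comap fun k => mem_range_self k).comap_le

open Classical in
/-- Flipping the coin at `k`. -/
noncomputable def flipCoin {I : Type u} (k : I) (x : I → Bool) (i : I) : Bool :=
  (if i = k then not else id) (x i)

theorem measurePreserving_flipCoin {I : Type u} (k : I) :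
    MeasurePreserving (flipCoin k) (coinMeasure I) (coinMeasure I) := by
  classical
  have hm : ∀ i, Measurable (if i = k then not else id : Bool → Bool) := fun i =>
    measurable_of_countable _
  refine ⟨measurable_pi_lambda _ fun i => (hm i).comp (measurable_pi_apply i), ?_⟩
  refine (Measure.infinitePi_map_pi _ hm).trans ?_
  congr 1
  funext i
  split_ifs
  · refine Measure.ext_of_singleton fun c => ?_
    rw [Measure.map_apply (measurable_of_countable _) (measurableSet_singleton c)]
    have : (not ⁻¹' {c} : Set Bool) = {!c} := by ext d; cases c <;> cases d <;> simp
    rw [this]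
    simp
  · exact Measure.map_id

/-- An event that depends only on coordinates outside a finite set `F` is independent of the
values of the coordinates in `F`. -/
theorem coinMeasure_inter_eq {I : Type u} {T : Set I} {H : Set (I → Bool)}
    (hH : MeasurableSet[⨆ i ∈ T, MeasurableSpace.comap (fun x : I → Bool => x i) inferInstance] H)
    (F : Finset I) (hF : Disjoint T (F : Set I)) (s : I → Bool) :
    coinMeasure I (H ∩ {x | ∀ i ∈ F, x i = s i}) = coinMeasure I H * 2⁻¹ ^ F.card := by
  have h := indep_coinMeasure hF
  have hbox : {x : I → Bool | ∀ i ∈ F, x i = s i} = (F : Set I).pi fun i => {s i} := by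
    ext x; simp
  rw [(ProbabilityTheory.Indep_iff _ _ _).1 h H _ hH, hbox]
  · congr 1
    rw [coinMeasure, Measure.infinitePi_pi _ (fun i _ => measurableSet_singleton _)]
    simp
  · have : {x : I → Bool | ∀ i ∈ F, x i = s i} = ⋂ i ∈ F, (fun x : I → Bool => x i) ⁻¹' {s i} := by
      ext x; simp
    rw [this]
    refine F.measurableSet_biInter fun i hi => ?_
    exact le_iSup₂ (f := fun i (_ : i ∈ (F : Set I)) =>
      MeasurableSpace.comap (fun x : I → Bool => x i) inferInstance) i hi _
      ⟨{s i}, measurableSet_singleton _, rfl⟩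

/-! ### Free extensions -/

section FreeExtension

variable {A B I : Type u} [BooleanAlgebra A] [BooleanAlgebra B]

/-- The elements `γ i` are free over the image of `f`: every truth assignment on `A` extends to
`B` with arbitrary prescribed values at the `γ i`. -/
def IsFreeOver (f : BoundedLatticeHom A B) (γ : I → B) : Prop :=
  ∀ t : A → Prop, IsTruthAssignment t → ∀ w : I → Prop,
    ∃ v : B → Prop, IsTruthAssignment v ∧ (∀ p, v (f p) ↔ t p) ∧ ∀ i, v (γ i) ↔ w i

/-- The element of the interval `(f (a i), f (b i))` that follows `γ i` inside `f (b i \ a i)`. -/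
def intervalElement (f : BoundedLatticeHom A B) (a b : I → A) (γ : I → B) (i : I) : B :=
  f (a i) ⊔ (f (b i) ⊓ γ i)

variable {f : BoundedLatticeHom A B} {a b : I → A} {γ : I → B}

theorem intervalElement_mem (hab : ∀ i, a i ≤ b i) (i : I) :
    f (a i) ≤ intervalElement f a b γ i ∧ intervalElement f a b γ i ≤ f (b i) :=
  ⟨le_sup_left, sup_le (OrderHomClass.mono f (hab i)) inf_le_left⟩

variable (f a b γ) in
/-- The subalgebra generated by the image of `f` and the interval elements. -/
def intervalExtension : BooleanSubalgebra B :=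
  BooleanSubalgebra.closure (range f ∪ range (intervalElement f a b γ))

variable (f a b γ) in
/-- The base algebra inside the interval extension. -/
def intervalExtension.base : BoundedLatticeHom A (intervalExtension f a b γ) where
  toFun p := ⟨f p, BooleanSubalgebra.subset_closure (Or.inl ⟨p, rfl⟩)⟩
  map_sup' p q := Subtype.ext (map_sup f p q)
  map_inf' p q := Subtype.ext (map_inf f p q)
  map_top' := Subtype.ext (map_top f)
  map_bot' := Subtype.ext (map_bot f)

variable (f a b γ) in
/-- The interval elements inside the interval extension. -/
def intervalExtension.elt (i : I) : intervalExtension f a b γ :=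
  ⟨intervalElement f a b γ i, BooleanSubalgebra.subset_closure (Or.inr ⟨i, rfl⟩)⟩

/-- Relations among interval elements over a free family hold in every other system of solutions:
the graph `{(f p, g p)} ∪ {(x i, y i)}` generates the graph of a function. -/
theorem IsFreeOver.eq_of_mem_closure (hγ : IsFreeOver f γ) {C : Type u} [BooleanAlgebra C]
    (g : BoundedLatticeHom A C) (y : I → C) (hy : ∀ i, g (a i) ≤ y i ∧ y i ≤ g (b i))
    {G : BooleanSubalgebra (B × C)}
    (hG : G = BooleanSubalgebra.closure ((range fun p => (f p, g p)) ∪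
      range fun i => (intervalElement f a b γ i, y i)))
    {r : B} {c c' : C} (h : (r, c) ∈ G) (h' : (r, c') ∈ G) : c = c' := by
  have key : ∀ {c : C}, ((⊥ : B), c) ∈ G → c = ⊥ := by
    intro c hc
    by_contra hne
    obtain ⟨t, ht, htc⟩ := IsTruthAssignment.exists_of_ne_bot hne
    obtain ⟨v, hv, hvf, hvγ⟩ := hγ (fun p => t (g p)) (ht.comp g) (fun i => t (y i))
    rw [hG] at hc
    have hfst : IsTruthAssignment fun z : B × C => v z.1 :=
      ⟨fun z w => hv.inf _ _, fun z => hv.compl _⟩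
    have hsnd : IsTruthAssignment fun z : B × C => t z.2 :=
      ⟨fun z w => ht.inf _ _, fun z => ht.compl _⟩
    refine hv.bot ((hfst.eq_on_closure hsnd ?_ hc).2 htc)
    rintro _ (⟨p, rfl⟩ | ⟨i, rfl⟩)
    · exact hvf p
    · change v (f (a i) ⊔ (f (b i) ⊓ γ i)) ↔ t (y i)
      rw [hv.sup, hv.inf, hvf, hvf, hvγ]
      have h1 := ht.mono (hy i).1
      have h2 := ht.mono (hy i).2
      tauto
  have hd : ((⊥ : B), c ∆ c') ∈ G := by
    have hmem := G.sup_mem (G.sdiff_mem h h') (G.sdiff_mem h' h)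
    have heq : (r, c) \ (r, c') ⊔ (r, c') \ (r, c) = ((⊥ : B), c ∆ c') :=
      Prod.ext (by simp) rfl
    rwa [heq] at hmem
  exact symmDiff_eq_bot.1 (key hd)

/-- Intervals filled by means of free elements give the free extension. -/
theorem IsFreeOver.isFreeExtension (hγ : IsFreeOver f γ) (hab : ∀ i, a i ≤ b i) :
    IsFreeExtension a b (intervalExtension.base f a b γ) (intervalExtension.elt f a b γ) := by
  refine ⟨fun i => intervalElement_mem hab i, fun C _ g y hy => ?_⟩
  obtain ⟨G, hG⟩ : ∃ G : BooleanSubalgebra (B × C), G = BooleanSubalgebra.closure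
    ((range fun p => (f p, g p)) ∪ range fun i => (intervalElement f a b γ i, y i)) := ⟨_, rfl⟩
  have hGf : ∀ p, (f p, g p) ∈ G := fun p => by
    rw [hG]; exact BooleanSubalgebra.subset_closure (Or.inl ⟨p, rfl⟩)
  have hGx : ∀ i, (intervalElement f a b γ i, y i) ∈ G := fun i => by
    rw [hG]; exact BooleanSubalgebra.subset_closure (Or.inr ⟨i, rfl⟩)
  have huniq : ∀ {r : B} {c c' : C}, (r, c) ∈ G → (r, c') ∈ G → c = c' :=
    fun h h' => hγ.eq_of_mem_closure g y hy hG h h'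
  have hex : ∀ r : intervalExtension f a b γ, ∃ c, ((r : B), c) ∈ G := by
    rintro ⟨r, hr⟩
    change ∃ c, (r, c) ∈ G
    induction hr using BooleanSubalgebra.closure_bot_sup_induction with
    | mem x hx =>
      obtain ⟨p, rfl⟩ | ⟨i, rfl⟩ := hx
      exacts [⟨_, hGf p⟩, ⟨_, hGx i⟩]
    | bot => exact ⟨⊥, G.bot_mem⟩
    | sup x _ y _ hx hy =>
      obtain ⟨c, hc⟩ := hx
      obtain ⟨d, hd⟩ := hy
      exact ⟨c ⊔ d, G.sup_mem hc hd⟩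
    | compl x _ hx =>
      obtain ⟨c, hc⟩ := hx
      exact ⟨cᶜ, G.compl_mem hc⟩
  choose h hh using hex
  let H : BoundedLatticeHom (intervalExtension f a b γ) C :=
    { toFun := h
      map_sup' := fun r s => huniq (hh (r ⊔ s)) (G.sup_mem (hh r) (hh s))
      map_inf' := fun r s => huniq (hh (r ⊓ s)) (G.inf_mem (hh r) (hh s))
      map_top' := huniq (hh ⊤) G.top_mem
      map_bot' := huniq (hh ⊥) G.bot_mem }
  refine ⟨H, ⟨fun p => huniq (hh _) (hGf p), fun i => huniq (hh _) (hGx i)⟩, ?_⟩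
  rintro H' ⟨hf', hx'⟩
  have : ∀ r (hr : r ∈ intervalExtension f a b γ), (r, H' ⟨r, hr⟩) ∈ G := by
    intro r hr
    induction hr using BooleanSubalgebra.closure_bot_sup_induction with
    | mem x hx =>
      obtain ⟨p, rfl⟩ | ⟨i, rfl⟩ := hx
      · have := hGf p
        rw [← hf' p] at this
        exact this
      · have := hGx i
        rw [← hx' i] at this
        exact this
    | bot => exact (map_bot H').symm ▸ G.bot_mem
    | sup x hx y hy h1 h2 =>
      have := G.sup_mem h1 h2
      rw [Prod.mk_sup_mk, ← map_sup] at this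
      exact this
    | compl x hx h1 =>
      have := G.compl_mem h1
      have heq : (x, H' ⟨x, hx⟩)ᶜ = (xᶜ, H' ⟨x, hx⟩ᶜ) := Prod.ext rfl (map_compl' H' _).symm
      rw [heq] at this
      exact this
  exact DFunLike.ext H' H fun r => huniq (this r r.2) (hh r)

/-- Every free extension embeds in `B`. -/
theorem IsFreeOver.exists_injective_hom (hγ : IsFreeOver f γ) (hab : ∀ i, a i ≤ b i)
    {B' : Type u} [BooleanAlgebra B'] {f' : BoundedLatticeHom A B'} {x : I → B'}
    (h : IsFreeExtension a b f' x) :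
    ∃ φ : BoundedLatticeHom B' B, Function.Injective φ ∧
      ∀ i, φ (x i) = intervalElement f a b γ i := by
  have h0 := hγ.isFreeExtension hab
  obtain ⟨φ, ⟨hφf, hφx⟩, -⟩ := h.2 _ _ _ h0.1
  obtain ⟨ψ, ⟨hψf, hψx⟩, -⟩ := h0.2 _ _ _ h.1
  have hid : ψ.comp φ = BoundedLatticeHom.id B' :=
    (h.2 _ _ _ h.1).unique ⟨fun p => by simp [hφf, hψf], fun i => by simp [hφx, hψx]⟩
      ⟨fun p => rfl, fun i => rfl⟩
  refine ⟨(BooleanSubalgebra.subtype _).comp φ, ?_, fun i => congrArg Subtype.val (hφx i)⟩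
  refine (BooleanSubalgebra.subtype_injective _).comp (Function.LeftInverse.injective (g := ψ) ?_)
  exact fun r => DFunLike.congr_fun hid r

/-- Anti-independence, strong or medium, as used below: the interval elements over a free family
generate no large independent set. -/
theorem IsFreeOver.noIndependentSubset (hγ : IsFreeOver f γ) (hf : Function.Injective f)
    (h : StronglyAntiIndependent #I a b ∨ MediumlyAntiIndependent #I a b) :
    NoIndependentSubset #I
      (BooleanSubalgebra.closure (range (intervalElement f a b γ)) : Set B) := by
  obtain h | h := h
  · have := h.2 B f hf univ mk_univ (intervalElement f a b γ)
      fun i _ => intervalElement_mem h.1 i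
    rwa [image_univ] at this
  · have h1 := h.2 _ _ _ (hγ.isFreeExtension h.1)
    rintro ⟨J, hJ, hJi, hJc⟩
    let val := BooleanSubalgebra.subtype (intervalExtension f a b γ)
    have hle : BooleanSubalgebra.closure (range (intervalElement f a b γ)) ≤
        (BooleanSubalgebra.closure (range (intervalExtension.elt f a b γ))).map val := by
      refine BooleanSubalgebra.closure_le.2 ?_
      rintro _ ⟨i, rfl⟩
      exact ⟨_, BooleanSubalgebra.subset_closure ⟨i, rfl⟩, rfl⟩
    have himg : val '' (val ⁻¹' J) = J := by
      refine image_preimage_eq_of_subset fun r hr => ?_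
      obtain ⟨z, -, rfl⟩ := hle (hJ hr)
      exact ⟨z, rfl⟩
    refine h1 ⟨val ⁻¹' J, fun z hz => ?_, IsIndependent.of_image
      (BooleanSubalgebra.subtype_injective _) (himg.symm ▸ hJi), ?_⟩
    · obtain ⟨z', hz', hzz⟩ := hle (hJ hz)
      rwa [← BooleanSubalgebra.subtype_injective _ hzz]
    · rw [← hJc, ← mk_image_eq (s := val ⁻¹' J) (BooleanSubalgebra.subtype_injective _)]
      exact congrArg (fun s : Set B => #s) himg

end FreeExtension

/-! ### Free extensions inside the Maharam algebra -/

/-- The free generators of the Maharam algebra. -/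
noncomputable def MaharamAlgebra.gen {I : Type u} (i : I) : MaharamAlgebra I :=
  MeasureAlgebra.mk _ ⟨(fun x => x i) ⁻¹' {true},
    measurable_pi_apply i (measurableSet_singleton true)⟩

section

variable {I K J : Type u} {j₁ : K → I} {j₂ : J → I}

/-- The generators at the coordinates `j₂ i` are free over the algebra of the coordinates `j₁ k`,
because nonempty events about disjoint sets of coordinates are independent. -/
theorem isFreeOver_gen (h₁ : Function.Injective j₁) (hd : ∀ k i, j₁ k ≠ j₂ i)
    (h₂ : Function.Injective j₂) :
    IsFreeOver (MeasureAlgebra.pullback (measurePreserving_coinMeasure_comp h₁))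
      (fun i => MaharamAlgebra.gen (j₂ i)) := by
  classical
  intro t ht w
  set f := MeasureAlgebra.pullback (measurePreserving_coinMeasure_comp h₁)
  let s : I → Bool := fun l => decide (∃ i, j₂ i = l ∧ w i)
  have hs : ∀ i, s (j₂ i) = true ↔ w i := fun i => by
    simp only [s, decide_eq_true_eq]
    exact ⟨fun ⟨i', h, h'⟩ => h₂ h ▸ h', fun h => ⟨i, rfl, h⟩⟩
  have hmeas : ∀ G : Finset J, MeasurableSet {x : I → Bool | ∀ l ∈ G.image j₂, x l = s l} := by
    intro G
    have : {x : I → Bool | ∀ l ∈ G.image j₂, x l = s l} =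
        ⋂ l ∈ G.image j₂, (fun x => x l) ⁻¹' {s l} := by
      ext x; simp
    rw [this]
    exact Finset.measurableSet_biInter _ fun l _ =>
      measurable_pi_apply l (measurableSet_singleton _)
  -- the event that the coins at the coordinates `j₂ i`, for `i ∈ G`, show what `w` prescribes
  let cyl : Finset J → MaharamAlgebra I := fun G => MeasureAlgebra.mk _ ⟨_, hmeas G⟩
  have hcyl : ∀ G G' : Finset J, G ⊆ G' → cyl G' ≤ cyl G := fun G G' hG =>
    Filter.Eventually.of_forall fun x hx l hl => hx l (Finset.image_subset_image hG hl)
  have hne : ∀ (p : MaharamAlgebra K) (G : Finset J), p ≠ ⊥ → f p ⊓ cyl G ≠ ⊥ := by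
    intro p G hp h0
    induction p using MeasureAlgebra.ind with
    | h P =>
      rw [← MeasureAlgebra.leb_eq_zero] at h0
      have h1 : coinMeasure I (((fun (x : I → Bool) k => x (j₁ k)) ⁻¹' P) ∩
          {x | ∀ l ∈ G.image j₂, x l = s l}) = 0 := h0
      rw [coinMeasure_inter_eq (T := range j₁)
        (measurable_comp_iSup_comap (fun k => mem_range_self k) P.2)] at h1
      · rw [(measurePreserving_coinMeasure_comp h₁).measure_preimage P.2.nullMeasurableSet] at h1
        refine hp (MeasureAlgebra.leb_eq_zero.1 ((mul_eq_zero.1 h1).resolve_right ?_))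
        simp
      · rw [Set.disjoint_left]
        rintro _ ⟨k, rfl⟩ hk
        obtain ⟨i, -, hi⟩ := Finset.mem_image.1 (Finset.mem_coe.1 hk)
        exact hd k i hi.symm
  obtain ⟨v, hv, hvS⟩ := IsTruthAssignment.exists_of_finset_inf_ne_bot
    (S := f '' {p | t p} ∪ range fun i => if w i then MaharamAlgebra.gen (j₂ i)
      else (MaharamAlgebra.gen (j₂ i))ᶜ) fun F hF => by
    suffices h : ∃ p G, t p ∧ f p ⊓ cyl G ≤ F.inf id by
      obtain ⟨p, G, hp, hle⟩ := h
      intro h0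
      exact hne p G (fun h => ht.bot (h ▸ hp)) (le_bot_iff.1 (h0 ▸ hle))
    induction F using Finset.induction_on with
    | empty => exact ⟨⊤, ∅, ht.top, by simp⟩
    | insert r F _ ih =>
      rw [Finset.coe_insert, Set.insert_subset_iff] at hF
      obtain ⟨p, G, hp, hle⟩ := ih hF.2
      rw [Finset.inf_insert]
      obtain ⟨q, hq, rfl⟩ | ⟨i, rfl⟩ := hF.1
      · refine ⟨p ⊓ q, G, (ht.inf _ _).2 ⟨hp, hq⟩, le_inf ?_ ?_⟩
        · exact inf_le_left.trans (OrderHomClass.mono f inf_le_right)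
        · exact (inf_le_inf_right _ (OrderHomClass.mono f inf_le_left)).trans hle
      · refine ⟨p, insert i G, hp, le_inf (inf_le_right.trans ?_)
          ((inf_le_inf_left _ (hcyl _ _ (Finset.subset_insert i G))).trans hle)⟩
        dsimp only [id]
        have hi : ∀ x ∈ {x : I → Bool | ∀ l ∈ (insert i G).image j₂, x l = s l},
            x (j₂ i) = s (j₂ i) := fun x hx => hx _ (by simp)
        split_ifs with hw
        · exact MeasureAlgebra.mk_le_mk_of_subset fun x hx => (hi x hx).trans ((hs i).2 hw)
        · refine MeasureAlgebra.mk_le_mk_of_subset (t := ⟨_,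
            (measurable_pi_apply (j₂ i) (measurableSet_singleton true)).compl⟩)
            fun x hx hx' => hw ((hs i).1 ?_)
          rw [← hi x hx]
          exact hx'
  refine ⟨v, hv, fun p => ⟨fun h => ?_, fun h => hvS _ (Or.inl ⟨p, h, rfl⟩)⟩, fun i => ?_⟩
  · by_contra hp
    have := hvS _ (Or.inl ⟨pᶜ, (ht.compl p).2 hp, rfl⟩)
    rw [map_compl', hv.compl] at this
    exact this h
  · have := hvS _ (Or.inr ⟨i, rfl⟩)
    dsimp only at this
    split_ifs at this with hw
    · exact iff_of_true this hw
    · exact iff_of_false ((hv.compl _).1 this) hw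

end

/-! ### The conditional distribution transform -/

/-- The uniform distribution on the unit interval, as a measure on the line. -/
noncomputable def uniformMeasure : Measure ℝ := volume.restrict (Icc 0 1)

instance uniformMeasure.isProbabilityMeasure : IsProbabilityMeasure uniformMeasure :=
  ⟨by simp [uniformMeasure]⟩

section DistributionTransform

open ProbabilityTheory

theorem continuous_cdf_of_noAtoms (κ : Measure ℝ) [IsProbabilityMeasure κ] [NullSingletonClass κ] :
    Continuous (cdf κ) := by
  refine continuous_iff_continuousAt.2 fun a => ?_
  refine (cdf κ).mono.continuousAt_iff_leftLim_eq_rightLim.2 ?_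
  have h : (cdf κ).measure {a} = 0 := by rw [measure_cdf]; exact measure_singleton a
  rw [StieltjesFunction.measure_singleton, ENNReal.ofReal_eq_zero, sub_nonpos] at h
  rw [StieltjesFunction.rightLim_eq]
  exact le_antisymm ((cdf κ).mono.leftLim_le le_rfl) h

/-- A random variable with continuous distribution function is uniformly distributed after
application of that function. -/
theorem measure_cdf_le (κ : Measure ℝ) [IsProbabilityMeasure κ] [NullSingletonClass κ] {s : ℝ}
    (h0 : 0 ≤ s) (h1 : s ≤ 1) : κ {r | cdf κ r ≤ s} = ENNReal.ofReal s := by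
  have hc := continuous_cdf_of_noAtoms κ
  have main : ∀ s : ℝ, 0 < s → s < 1 → κ {r | cdf κ r ≤ s} = ENNReal.ofReal s := by
    intro s h0 h1
    obtain ⟨r₁, hr₁⟩ := ((tendsto_cdf_atBot κ).eventually_lt_const h0).exists
    obtain ⟨r₂, hr₂⟩ := ((tendsto_cdf_atTop κ).eventually_const_lt h1).exists
    obtain ⟨r, hr⟩ := mem_range_of_exists_le_of_exists_ge hc ⟨r₁, hr₁.le⟩ ⟨r₂, hr₂.le⟩
    have hbdd : BddAbove {r | cdf κ r ≤ s} :=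
      ⟨r₂, fun x hx => le_of_not_gt fun h => (hr₂.trans_le (monotone_cdf κ h.le)).not_ge hx⟩
    have hmem : sSup {r | cdf κ r ≤ s} ∈ {r | cdf κ r ≤ s} :=
      (isClosed_le hc continuous_const).csSup_mem ⟨r, hr.le⟩ hbdd
    have hset : {r | cdf κ r ≤ s} = Iic (sSup {r | cdf κ r ≤ s}) :=
      Subset.antisymm (fun x hx => le_csSup hbdd hx)
        fun x hx => (monotone_cdf κ hx).trans hmem
    have heq : cdf κ (sSup {r | cdf κ r ≤ s}) = s :=
      le_antisymm hmem (hr.symm.le.trans (monotone_cdf κ (le_csSup hbdd hr.le)))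
    rw [hset, ← ofReal_cdf κ, heq]
  rcases h0.eq_or_lt with rfl | h0
  · refine le_antisymm (le_of_forall_gt fun c hc => ?_) (by simp)
    rw [ENNReal.ofReal_zero] at hc
    obtain ⟨δ, -, hδ, hδc⟩ := ENNReal.lt_iff_exists_real_btwn.1 hc
    have hδ0 := ENNReal.ofReal_pos.1 hδ
    have hlt : min δ 2⁻¹ < 1 := (min_le_right _ _).trans_lt (by norm_num)
    calc κ {r | cdf κ r ≤ 0} ≤ κ {r | cdf κ r ≤ min δ 2⁻¹} :=
          measure_mono fun r (hr : cdf κ r ≤ 0) => hr.trans (by positivity)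
      _ = ENNReal.ofReal (min δ 2⁻¹) := main _ (by positivity) hlt
      _ ≤ ENNReal.ofReal δ := ENNReal.ofReal_le_ofReal (min_le_left _ _)
      _ < c := hδc
  · rcases h1.eq_or_lt with rfl | h1
    · have : {r | cdf κ r ≤ 1} = Set.univ := eq_univ_of_forall fun r => cdf_le_one κ r
      simp [this]
    · exact main s h0 h1

/-- The probability integral transform. -/
theorem map_cdf_eq_uniformMeasure (κ : Measure ℝ) [IsProbabilityMeasure κ] [NullSingletonClass κ] :
    κ.map (cdf κ) = uniformMeasure := by
  have hm : Measurable (cdf κ) := (monotone_cdf κ).measurable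
  have : IsProbabilityMeasure (κ.map (cdf κ)) := Measure.isProbabilityMeasure_map hm.aemeasurable
  refine Measure.ext_of_Iic _ _ fun s => ?_
  rw [Measure.map_apply hm measurableSet_Iic, uniformMeasure,
    Measure.restrict_apply measurableSet_Iic]
  change κ {r | cdf κ r ≤ s} = _
  rcases lt_or_ge s 0 with h0 | h0
  · have h1 : {r | cdf κ r ≤ s} = ∅ :=
      eq_empty_of_forall_notMem fun r hr => (h0.trans_le (cdf_nonneg κ r)).not_ge hr
    have h2 : Iic s ∩ Icc (0 : ℝ) 1 = ∅ :=
      eq_empty_of_forall_notMem fun r hr => (hr.1.trans_lt h0).not_ge hr.2.1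
    simp [h1, h2]
  · rcases le_or_gt s 1 with h1 | h1
    · have h2 : Iic s ∩ Icc (0 : ℝ) 1 = Icc 0 s := by
        ext x; simp only [mem_inter_iff, mem_Iic, mem_Icc]; constructor
        · tauto
        · exact fun h => ⟨h.2, h.1, h.2.trans h1⟩
      rw [measure_cdf_le κ h0 h1, h2, Real.volume_Icc, sub_zero]
    · have h2 : Iic s ∩ Icc (0 : ℝ) 1 = Icc 0 1 :=
        inter_eq_right.2 fun x hx => hx.2.trans h1.le
      have h3 : {r | cdf κ r ≤ s} = Set.univ :=
        eq_univ_of_forall fun r => (cdf_le_one κ r).trans h1.le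
      simp [h2, h3]

variable {Y : Type u} [MeasurableSpace Y]

/-- A joint law of a pair whose second component, conditionally on the first, is diffuse.  The
condition is spelled out without conditional laws: there are finite partitions of the line whose
cells have uniformly small conditional probability. -/
def IsConditionallyDiffuse (ρ : Measure (Y × ℝ)) : Prop :=
  ∀ ε : ℝ≥0∞, 0 < ε → ∃ (N : ℕ) (q : ℝ → Fin N → Bool) (ν : Measure Y), Measurable q ∧
    ν univ ≤ ε ∧ ∀ H, MeasurableSet H → ∀ s, ρ (H ×ˢ (q ⁻¹' {s})) ≤ ν H

variable {ρ : Measure (Y × ℝ)} [IsProbabilityMeasure ρ]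

theorem measure_eq_lintegral_condKernel {s : Set (Y × ℝ)} (hs : MeasurableSet s) :
    ρ s = ∫⁻ y, ρ.condKernel y (Prod.mk y ⁻¹' s) ∂ρ.fst := by
  conv_lhs => rw [← ρ.disintegrate ρ.condKernel]
  exact Measure.compProd_apply hs

theorem setLIntegral_condKernel_eq {H : Set Y} (hH : MeasurableSet H) {D : Set ℝ}
    (hD : MeasurableSet D) : ∫⁻ y in H, ρ.condKernel y D ∂ρ.fst = ρ (H ×ˢ D) := by
  conv_rhs => rw [← ρ.disintegrate ρ.condKernel]
  exact (Measure.compProd_apply_prod hH hD).symm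

/-- Almost all conditional laws are diffuse: the sum of the squares of the conditional
probabilities of the cells bounds the square of the mass of every atom, and its integral is at
most the total mass of `ν`. -/
theorem IsConditionallyDiffuse.ae_noAtoms (h : IsConditionallyDiffuse ρ) :
    ∀ᵐ y ∂ρ.fst, NullSingletonClass (ρ.condKernel y) := by
  have hpos : ∀ n : ℕ, (0 : ℝ≥0∞) < (n + 1 : ℝ≥0∞)⁻¹ := fun n => by simp
  choose N q ν hq hν hle using fun n : ℕ => h _ (hpos n)
  have hD : ∀ n s, MeasurableSet (q n ⁻¹' {s}) := fun n s => hq n (measurableSet_singleton s)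
  have hκ : ∀ n s, Measurable fun y => ρ.condKernel y (q n ⁻¹' {s}) := fun n s =>
    Kernel.measurable_coe _ (hD n s)
  let g : ℕ → Y → ℝ≥0∞ := fun n y => ∑ s, ρ.condKernel y (q n ⁻¹' {s}) ^ 2
  have hgm : ∀ n, Measurable (g n) := fun n =>
    Finset.measurable_sum _ fun s _ => (hκ n s).pow_const 2
  have hg : ∀ n, ∫⁻ y, g n y ∂ρ.fst ≤ (n + 1 : ℝ≥0∞)⁻¹ := by
    intro n
    have hdens : ∀ s, ρ.fst.withDensity (fun y => ρ.condKernel y (q n ⁻¹' {s})) ≤ ν n :=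
      fun s => Measure.le_iff.2 fun H hH => by
        rw [withDensity_apply _ hH, setLIntegral_condKernel_eq hH (hD n s)]
        exact hle n H hH s
    have hone : ∀ y, ∑ s, ρ.condKernel y (q n ⁻¹' {s}) = 1 := fun y => by
      rw [← measure_univ (μ := ρ.condKernel y),
        sum_measure_preimage_singleton _ fun s _ => hD n s]
      simp
    calc ∫⁻ y, g n y ∂ρ.fst
        = ∑ s, ∫⁻ y, ρ.condKernel y (q n ⁻¹' {s}) ^ 2 ∂ρ.fst :=
          lintegral_finsetSum _ fun s _ => (hκ n s).pow_const 2
      _ = ∑ s, ∫⁻ y, ρ.condKernel y (q n ⁻¹' {s})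
            ∂(ρ.fst.withDensity fun y => ρ.condKernel y (q n ⁻¹' {s})) := by
          refine Finset.sum_congr rfl fun s _ => ?_
          rw [lintegral_withDensity_eq_lintegral_mul _ (hκ n s) (hκ n s)]
          simp [sq]
      _ ≤ ∑ s, ∫⁻ y, ρ.condKernel y (q n ⁻¹' {s}) ∂(ν n) :=
          Finset.sum_le_sum fun s _ => lintegral_mono' (hdens s) le_rfl
      _ = ∫⁻ y, ∑ s, ρ.condKernel y (q n ⁻¹' {s}) ∂(ν n) :=
          (lintegral_finsetSum _ fun s _ => hκ n s).symm
      _ = ν n univ := by simp [hone]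
      _ ≤ _ := hν n
  have hinf : ∫⁻ y, ⨅ n, g n y ∂ρ.fst = 0 := by
    refine le_antisymm (le_of_forall_gt fun c hc => ?_) bot_le
    obtain ⟨n, hn⟩ := ENNReal.exists_inv_nat_lt hc.ne'
    calc ∫⁻ y, ⨅ n, g n y ∂ρ.fst ≤ ∫⁻ y, g n y ∂ρ.fst := lintegral_mono fun y => iInf_le _ n
      _ ≤ (n + 1 : ℝ≥0∞)⁻¹ := hg n
      _ ≤ (n : ℝ≥0∞)⁻¹ := ENNReal.inv_le_inv.2 le_self_add
      _ < c := hn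
  rw [lintegral_eq_zero_iff (Measurable.iInf hgm)] at hinf
  filter_upwards [hinf] with y hy
  refine ⟨fun r => ?_⟩
  have h2 : ρ.condKernel y {r} ^ 2 ≤ ⨅ n, g n y := le_iInf fun n => by
    refine le_trans ?_ (Finset.single_le_sum (f := fun s => ρ.condKernel y (q n ⁻¹' {s}) ^ 2)
      (fun _ _ => bot_le) (Finset.mem_univ (q n r)))
    exact pow_le_pow_left' (measure_mono (by simp)) 2
  rw [hy] at h2
  exact pow_eq_zero_iff two_ne_zero |>.1 (le_bot_iff.1 h2)

variable (ρ) in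
/-- The conditional distribution function of the second component, evaluated at that component. -/
noncomputable def distributionTransform (p : Y × ℝ) : ℝ :=
  (ρ.condKernel p.1).real (Iic p.2)

theorem distributionTransform_mk (y : Y) (r : ℝ) :
    distributionTransform ρ (y, r) = cdf (ρ.condKernel y) r :=
  (cdf_eq_real _ r).symm

theorem measurable_distributionTransform : Measurable (distributionTransform ρ) := by
  let η : Kernel (Y × ℝ) ℝ := ρ.condKernel.comap Prod.fst measurable_fst
  have hs : MeasurableSet {z : (Y × ℝ) × ℝ | z.2 ≤ z.1.2} :=
    measurableSet_le measurable_snd measurable_fst.snd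
  exact (Kernel.measurable_kernel_prodMk_left (κ := η) hs).ennreal_toReal

theorem map_distributionTransform (h : ∀ᵐ y ∂ρ.fst, NullSingletonClass (ρ.condKernel y)) :
    ρ.map (fun p => (p.1, distributionTransform ρ p)) = ρ.fst.prod uniformMeasure := by
  have hm := measurable_distributionTransform (ρ := ρ)
  refine (Measure.prod_eq fun s t hs ht => ?_).symm
  rw [Measure.map_apply (by fun_prop) (hs.prod ht),
    measure_eq_lintegral_condKernel ((by fun_prop : Measurable
      fun p : Y × ℝ => (p.1, distributionTransform ρ p)) (hs.prod ht)), mul_comm,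
    ← lintegral_indicator_const hs]
  refine lintegral_congr_ae ?_
  filter_upwards [h] with y hy
  by_cases hys : y ∈ s
  · rw [indicator_of_mem hys, ← map_cdf_eq_uniformMeasure (ρ.condKernel y),
      Measure.map_apply (monotone_cdf _).measurable ht]
    congr 1
    ext r
    simp [hys, distributionTransform_mk]
  · rw [indicator_of_notMem hys]
    convert measure_empty (μ := ρ.condKernel y)
    ext r
    simp [hys]

/-- The second component is recovered from the first and from the transform: its conditional
distribution function is constant only on intervals of conditional measure zero. -/
theorem snd_le_ae_eq (h : ∀ᵐ y ∂ρ.fst, NullSingletonClass (ρ.condKernel y)) (c : ℝ) :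
    {p : Y × ℝ | p.2 ≤ c} =ᵐ[ρ]
      {p | distributionTransform ρ p ≤ (ρ.condKernel p.1).real (Iic c)} := by
  have hm := measurable_distributionTransform (ρ := ρ)
  have hmc : Measurable fun p : Y × ℝ => (ρ.condKernel p.1).real (Iic c) :=
    ((Kernel.measurable_coe _ measurableSet_Iic).comp measurable_fst).ennreal_toReal
  have hs₁ : MeasurableSet {p : Y × ℝ | p.2 ≤ c} := measurableSet_le measurable_snd measurable_const
  have hs₂ := measurableSet_le hm hmc
  have hsub : {p : Y × ℝ | p.2 ≤ c} ⊆
      {p | distributionTransform ρ p ≤ (ρ.condKernel p.1).real (Iic c)} :=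
    fun p hp => measureReal_mono (Iic_subset_Iic.2 hp)
  have hle : ρ {p | distributionTransform ρ p ≤ (ρ.condKernel p.1).real (Iic c)} ≤
      ρ {p : Y × ℝ | p.2 ≤ c} := by
    rw [measure_eq_lintegral_condKernel hs₁, measure_eq_lintegral_condKernel hs₂]
    refine (lintegral_congr_ae ?_).le
    filter_upwards [h] with y hy
    have h1 := measure_cdf_le (ρ.condKernel y) (cdf_nonneg (ρ.condKernel y) c)
      (cdf_le_one (ρ.condKernel y) c)
    rw [ofReal_cdf] at h1
    calc _ = ρ.condKernel y {r | cdf (ρ.condKernel y) r ≤ cdf (ρ.condKernel y) c} := by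
          congr 1
          ext r
          simp [distributionTransform_mk, cdf_eq_real]
      _ = ρ.condKernel y (Iic c) := h1
  exact ae_eq_of_subset_of_measure_ge hsub hle hs₁.nullMeasurableSet (measure_ne_top _ _)

end DistributionTransform

/-! ### Diffuse chains of random variables are equivalent to independent uniform ones -/

section DiffuseChain

variable {L : Type u} [LinearOrder L]

/-- The coordinates before `β`. -/
def past (β : L) (x : L → ℝ) : Iio β → ℝ := fun γ => x γ

theorem measurable_past (β : L) : Measurable (past β) := by unfold past; fun_prop

/-- The joint law of the coordinates before `β` and the coordinate `β`. -/
noncomputable def pastLaw (P : Measure (L → ℝ)) (β : L) : Measure ((Iio β → ℝ) × ℝ) :=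
  P.map fun x => (past β x, x β)

theorem measurable_past_pair (β : L) : Measurable fun x : L → ℝ => (past β x, x β) :=
  (measurable_past β).prodMk (measurable_pi_apply β)

variable {P : Measure (L → ℝ)} [IsProbabilityMeasure P]

instance pastLaw.isProbabilityMeasure (β : L) : IsProbabilityMeasure (pastLaw P β) :=
  Measure.isProbabilityMeasure_map (measurable_past_pair β).aemeasurable

variable (P) in
/-- Each coordinate is replaced by its distribution transform conditionally on the coordinates
before it. -/
noncomputable def chainTransform (x : L → ℝ) (β : L) : ℝ :=
  distributionTransform (pastLaw P β) (past β x, x β)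

theorem measurable_chainTransform : Measurable (chainTransform P) :=
  measurable_pi_lambda _ fun β => measurable_distributionTransform.comp (measurable_past_pair β)

theorem measurable_chainTransform_past {γ β : L} (h : γ < β) :
    Measurable[MeasurableSpace.comap (past β) inferInstance] fun x => chainTransform P x γ := by
  have hcoord : ∀ δ : Iio β, Measurable[MeasurableSpace.comap (past β) inferInstance]
      fun x : L → ℝ => x δ := fun δ =>
    (measurable_pi_apply δ).comp (comap_measurable (past β))
  refine measurable_distributionTransform.comp ?_
  refine Measurable.prodMk (m := MeasurableSpace.comap (past β) inferInstance) ?_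
    (hcoord ⟨γ, h⟩)
  exact @measurable_pi_lambda _ _ _ (MeasurableSpace.comap (past β) inferInstance) _ _
    fun δ => hcoord ⟨δ, lt_trans δ.2 h⟩

/-- The transformed coordinate is uniform and independent of the past. -/
theorem measure_past_inter_chainTransform {β : L} (h : IsConditionallyDiffuse (pastLaw P β))
    {E : Set (L → ℝ)} (hE : MeasurableSet[MeasurableSpace.comap (past β) inferInstance] E)
    {t : Set ℝ} (ht : MeasurableSet t) :
    P (E ∩ {x | chainTransform P x β ∈ t}) = P E * uniformMeasure t := by
  obtain ⟨H, hH, rfl⟩ := hE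
  have hm : Measurable fun p : (Iio β → ℝ) × ℝ => (p.1, distributionTransform (pastLaw P β) p) :=
    measurable_fst.prodMk measurable_distributionTransform
  have h1 := congrArg (fun μ => μ (H ×ˢ t)) (map_distributionTransform h.ae_noAtoms)
  simp only [Measure.prod_prod] at h1
  have h2 : (pastLaw P β).fst H = P (past β ⁻¹' H) := by
    rw [pastLaw, Measure.fst_map_prodMk (measurable_pi_apply β),
      Measure.map_apply (measurable_past β) hH]
  rw [Measure.map_apply hm (hH.prod ht), h2] at h1
  rw [← h1]
  exact (Measure.map_apply (measurable_past_pair β) (hm (hH.prod ht))).symm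

theorem map_chainTransform (h : ∀ β, IsConditionallyDiffuse (pastLaw P β)) :
    P.map (chainTransform P) = Measure.infinitePi fun _ : L => uniformMeasure := by
  refine Measure.eq_infinitePi _ fun s t ht => ?_
  have hpi : MeasurableSet ((s : Set L).pi t) :=
    MeasurableSet.pi s.countable_toSet fun i _ => ht i
  rw [Measure.map_apply measurable_chainTransform hpi]
  induction s using Finset.induction_on_max with
  | empty => simp
  | insert β s hβ ih =>
    have hE : MeasurableSet[MeasurableSpace.comap (past β) inferInstance]
        (chainTransform P ⁻¹' (s : Set L).pi t) := by
      have : chainTransform P ⁻¹' (s : Set L).pi t =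
          ⋂ γ ∈ s, (fun x => chainTransform P x γ) ⁻¹' t γ := by
        ext x; simp [Set.pi]
      rw [this]
      exact Finset.measurableSet_biInter _ fun γ hγ =>
        measurable_chainTransform_past (hβ γ hγ) (ht γ)
    have hset : chainTransform P ⁻¹' ((insert β s : Finset L) : Set L).pi t =
        (chainTransform P ⁻¹' (s : Set L).pi t) ∩ {x | chainTransform P x β ∈ t β} := by
      ext x; simp [Set.pi, and_comm]
    have hnot : β ∉ s := fun hs => lt_irrefl β (hβ β hs)
    rw [hset, measure_past_inter_chainTransform (h β) hE (ht β), Finset.prod_insert hnot, mul_comm,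
      ih (MeasurableSet.pi s.countable_toSet fun i _ => ht i)]

/-- If the coordinates are conditionally diffuse along a well-order, they can be recovered from
their transforms. -/
theorem exists_ae_eq_chainTransform_preimage [WellFoundedLT L]
    (h : ∀ β, IsConditionallyDiffuse (pastLaw P β)) {s : Set (L → ℝ)} (hs : MeasurableSet s) :
    ∃ t, MeasurableSet t ∧ s =ᵐ[P] chainTransform P ⁻¹' t := by
  -- the sets that are determined, up to null sets, by the transforms
  let 𝒢 : MeasurableSpace (L → ℝ) :=
    eventuallyMeasurableSpace (MeasurableSpace.comap (chainTransform P) inferInstance) (ae P)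
  have hv : ∀ β, Measurable[𝒢] fun x => chainTransform P x β := fun β =>
    (((measurable_pi_apply β).comp (comap_measurable (chainTransform P))).mono
      le_eventuallyMeasurableSpace le_rfl)
  have key : ∀ β, Measurable[𝒢] fun x : L → ℝ => x β := by
    intro β
    induction β using WellFoundedLT.induction with
    | ind β ih =>
      have hpast : Measurable[𝒢] (past β) :=
        @measurable_pi_lambda _ _ _ 𝒢 _ _ fun γ => ih γ γ.2
      refine measurable_of_Iic (mδ := 𝒢) fun c => ?_
      have hc : Measurable fun y : Iio β → ℝ => ((pastLaw P β).condKernel y).real (Iic c) :=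
        (ProbabilityTheory.Kernel.measurable_coe _ measurableSet_Iic).ennreal_toReal
      have hset : MeasurableSet[𝒢] {x | chainTransform P x β ≤
          ((pastLaw P β).condKernel (past β x)).real (Iic c)} :=
        @measurableSet_le _ _ _ _ _ 𝒢 _ _ _ _ _ (hv β) (hc.comp hpast)
      have hae := (Measure.tendsto_ae_map (measurable_past_pair β).aemeasurable).eventually
        (snd_le_ae_eq (h β).ae_noAtoms c)
      obtain ⟨t, ht, hst⟩ := hset
      refine ⟨t, ht, Filter.EventuallyEq.trans ?_ hst⟩
      exact hae
  have hle : MeasurableSpace.pi ≤ 𝒢 :=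
    iSup_le fun β => (key β).comap_le
  obtain ⟨_, ⟨t, ht, rfl⟩, hst⟩ := hle s hs
  exact ⟨t, ht, hst⟩

end DiffuseChain

/-! ### Filling intervals by coin tosses -/

/-- A measure-preserving map `f` is essentially invertible if every measurable set is, up to a
null set, the preimage of a measurable set. -/
def EssentiallyInvertible {Ω Ω' : Type u} [MeasurableSpace Ω] [MeasurableSpace Ω'] (m : Measure Ω)
    (f : Ω → Ω') : Prop :=
  ∀ s, MeasurableSet s → ∃ t, MeasurableSet t ∧ s =ᵐ[m] f ⁻¹' t

theorem EssentiallyInvertible.comp {Ω Ω' Ω'' : Type u} [MeasurableSpace Ω] [MeasurableSpace Ω']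
    [MeasurableSpace Ω''] {m : Measure Ω} {m' : Measure Ω'} {f : Ω → Ω'} {g : Ω' → Ω''}
    (hg : EssentiallyInvertible m' g) (hf : EssentiallyInvertible m f)
    (hmf : MeasurePreserving f m m') : EssentiallyInvertible m (g ∘ f) := by
  intro s hs
  obtain ⟨t, ht, hst⟩ := hf s hs
  obtain ⟨r, hr, htr⟩ := hg t ht
  exact ⟨r, hr, hst.trans (hmf.quasiMeasurePreserving.preimage_ae_eq htr)⟩

section Filling

variable {Ω I K : Type u}

open Classical in
/-- The indicator of a point of the interval `(a i, b i)`, with a coin toss wherever there is a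
choice. -/
noncomputable def fillIntervals (a b : I → Set Ω) (j : I → K) (ω : Ω × (K → Bool)) (i : I) : Bool :=
  decide (ω.1 ∈ a i ∨ ω.1 ∈ b i ∧ ω.2 (j i) = true)

variable {a b : I → Set Ω} {j : I → K}

theorem fillIntervals_preimage_true (i : I) :
    {ω | fillIntervals a b j ω i = true} =
      (Prod.fst ⁻¹' a i) ∪ ((Prod.fst ⁻¹' b i) ∩ Prod.snd ⁻¹' ((fun x => x (j i)) ⁻¹' {true})) := by
  ext ω; simp [fillIntervals]

theorem measurable_fillIntervals [MeasurableSpace Ω] (ha : ∀ i, MeasurableSet (a i))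
    (hb : ∀ i, MeasurableSet (b i)) : Measurable (fillIntervals a b j) := by
  refine measurable_pi_lambda _ fun i => measurable_to_bool ?_
  change MeasurableSet {ω | fillIntervals a b j ω i = true}
  rw [fillIntervals_preimage_true]
  exact (measurable_fst (ha i)).union ((measurable_fst (hb i)).inter
    (measurable_snd (measurable_pi_apply (j i) (measurableSet_singleton true))))

end Filling

section Blocks

variable {L : Type u}

/-- A block `x (β, 0), x (β, 1), …` of bits is encoded as a real number. -/
noncomputable def encodeBlocks (x : L × ℕ → Bool) (β : L) : ℝ :=
  embeddingReal (ℕ → Bool) fun n => x (β, n)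

theorem measurable_encodeBlocks : Measurable (encodeBlocks (L := L)) :=
  measurable_pi_lambda _ fun β => (measurable_embeddingReal _).comp
    (measurable_pi_lambda _ fun n => measurable_pi_apply (β, n))

theorem exists_eq_encodeBlocks_preimage {s : Set (L × ℕ → Bool)} (hs : MeasurableSet s) :
    ∃ t, MeasurableSet t ∧ s = encodeBlocks ⁻¹' t := by
  have hle : MeasurableSpace.pi ≤ MeasurableSpace.comap (encodeBlocks (L := L)) inferInstance := by
    refine iSup_le ?_
    rintro ⟨β, n⟩ _ ⟨t, ht, rfl⟩
    refine ⟨(fun y => y β) ⁻¹' (embeddingReal (ℕ → Bool) '' {z | z n ∈ t}), ?_, ?_⟩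
    · exact measurable_pi_apply β
        ((measurableEmbedding_embeddingReal (ℕ → Bool)).measurableSet_image.2
          (measurable_pi_apply n ht))
    · ext x
      exact (measurableEmbedding_embeddingReal (ℕ → Bool)).injective.mem_set_image
  obtain ⟨t, ht, h⟩ := hle s hs
  exact ⟨t, ht, h.symm⟩

variable {Ω K : Type u} [MeasurableSpace Ω] {a b : L × ℕ → Set Ω} {j : L × ℕ → K}

open Classical in
/-- The indices of those among the first `N` intervals of the block `β` that leave a choice at
`ω`. -/
noncomputable def freeIndices (a b : L × ℕ → Set Ω) (β : L) (N : ℕ) (ω : Ω) : Finset ℕ :=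
  (Finset.range N).filter fun n => ω ∈ b (β, n) \ a (β, n)

theorem measurable_freeIndices_card (ha : ∀ i, MeasurableSet (a i)) (hb : ∀ i, MeasurableSet (b i))
    (β : L) (N : ℕ) : Measurable fun ω => (2⁻¹ : ℝ≥0∞) ^ (freeIndices a b β N ω).card := by
  classical
  have : ∀ ω, (freeIndices a b β N ω).card =
      ∑ n ∈ Finset.range N, (b (β, n) \ a (β, n)).indicator (fun _ => 1) ω := fun ω => by
    rw [freeIndices, Finset.card_filter]
    exact Finset.sum_congr rfl fun n _ => by simp [indicator_apply]
  simp_rw [this]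
  refine (measurable_of_countable fun k : ℕ => (2⁻¹ : ℝ≥0∞) ^ k).comp ?_
  exact Finset.measurable_sum _ fun n _ => measurable_const.indicator ((hb _).diff (ha _))

theorem tendsto_lintegral_freeIndices {P : Measure Ω} [IsProbabilityMeasure P]
    (ha : ∀ i, MeasurableSet (a i)) (hb : ∀ i, MeasurableSet (b i)) {β : L}
    (hfreq : ∀ᵐ ω ∂P, ∃ᶠ n in Filter.atTop, ω ∈ b (β, n) \ a (β, n)) :
    Filter.Tendsto (fun N => ∫⁻ ω, (2⁻¹ : ℝ≥0∞) ^ (freeIndices a b β N ω).card ∂P)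
      Filter.atTop (nhds 0) := by
  classical
  have h := tendsto_lintegral_of_dominated_convergence (μ := P) (f := fun _ => 0)
    (F := fun N ω => (2⁻¹ : ℝ≥0∞) ^ (freeIndices a b β N ω).card) (fun _ => 1)
    (fun N => measurable_freeIndices_card ha hb β N)
    (fun N => Filter.Eventually.of_forall fun ω => pow_le_one' (by simp) _) (by simp) ?_
  · simpa using h
  filter_upwards [hfreq] with ω hω
  refine (ENNReal.tendsto_pow_atTop_nhds_zero_of_lt_one (by simp)).comp ?_
  refine Filter.tendsto_atTop_atTop_of_monotone (fun N N' hN => ?_) fun k => ?_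
  · exact Finset.card_le_card (Finset.filter_subset_filter _ (Finset.range_subset_range.2 hN))
  · have hinf : {n | ω ∈ b (β, n) \ a (β, n)}.Infinite := Nat.frequently_atTop_iff_infinite.1 hω
    obtain ⟨F, hF, rfl⟩ := hinf.exists_subset_card_eq k
    refine ⟨F.sup id + 1, Finset.card_le_card fun n hn => ?_⟩
    exact Finset.mem_filter.2 ⟨Finset.mem_range.2 (Nat.lt_succ_of_le (Finset.le_sup (f := id) hn)),
      hF hn⟩

variable [LinearOrder L] {P : Measure Ω} [IsProbabilityMeasure P]

/-- If almost every point lies in infinitely many of the sets `b (β, n) \ a (β, n)`, then the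
block `β` is diffuse given the blocks before it: the coin tosses of the block are independent of
everything before. -/
theorem isConditionallyDiffuse_encodeBlocks (hj : Function.Injective j)
    (ha : ∀ i, MeasurableSet (a i)) (hb : ∀ i, MeasurableSet (b i)) {β : L}
    (hfreq : ∀ᵐ ω ∂P, ∃ᶠ n in Filter.atTop, ω ∈ b (β, n) \ a (β, n)) :
    IsConditionallyDiffuse (pastLaw
      ((P.prod (coinMeasure K)).map (encodeBlocks ∘ fillIntervals a b j)) β) := by
  classical
  intro ε hε
  obtain ⟨N, hN⟩ := ((tendsto_lintegral_freeIndices ha hb hfreq).eventually_le_const hε).exists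
  have hG := measurableEmbedding_embeddingReal (ℕ → Bool)
  -- `q` reads off the first `N` bits of a block from its code
  obtain ⟨q, hq, hqG⟩ := hG.exists_measurable_extend (g := fun z (k : Fin N) => z k)
    (by fun_prop) fun _ => ⟨fun _ => true⟩
  let W : Ω × (K → Bool) → L → ℝ := encodeBlocks ∘ fillIntervals a b j
  have hW : Measurable W := measurable_encodeBlocks.comp (measurable_fillIntervals ha hb)
  let θ : Ω → ℝ≥0∞ := fun ω => 2⁻¹ ^ (freeIndices a b β N ω).card
  have hθ : Measurable θ := measurable_freeIndices_card ha hb β N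
  have hpW : Measurable fun ω => past β (W ω) := (measurable_past β).comp hW
  let ν := ((P.prod (coinMeasure K)).withDensity fun ω => θ ω.1).map fun ω => past β (W ω)
  -- the mass of the part of an event that lies above a point of the base, weighted by `θ`
  have hν : ∀ H, MeasurableSet H → ν H =
      ∫⁻ ω, θ ω * coinMeasure K {x | past β (W (ω, x)) ∈ H} ∂P := by
    intro H hH
    have hE := hpW hH
    have hθE : Measurable (((fun ω => past β (W ω)) ⁻¹' H).indicator fun z => θ z.1) :=
      (hθ.comp measurable_fst).indicator hE
    rw [Measure.map_apply hpW hH, withDensity_apply _ hE, ← lintegral_indicator hE,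
      lintegral_prod _ hθE.aemeasurable]
    refine lintegral_congr fun ω => ?_
    have : MeasurableSet {x | past β (W (ω, x)) ∈ H} := measurable_prodMk_left hE
    rw [← lintegral_indicator_const this]
    rfl
  refine ⟨N, q, ν, hq, ?_, fun H hH s => ?_⟩
  · rw [hν _ MeasurableSet.univ]
    simpa using hN
  · rw [hν H hH, pastLaw, Measure.map_apply (measurable_past_pair β)
      (hH.prod (hq (measurableSet_singleton s))), Measure.map_apply hW
      (measurable_past_pair β (hH.prod (hq (measurableSet_singleton s)))), Measure.prod_apply
      (hW (measurable_past_pair β (hH.prod (hq (measurableSet_singleton s)))))]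
    refine lintegral_mono fun ω => ?_
    -- above `ω`, prescribing these bits fixes the coins in `F`, while the past uses those in `T`
    let s' : K → Bool := fun k => if h : ∃ n : Fin N, j (β, n) = k then s h.choose else true
    have hs' : ∀ n : Fin N, s' (j (β, n)) = s n := fun n => by
      have h : ∃ n' : Fin N, j (β, n') = j (β, n) := ⟨n, rfl⟩
      simp only [s', dif_pos h]
      congr 1
      exact Fin.ext (Prod.ext_iff.1 (hj h.choose_spec)).2
    let F : Finset K := (freeIndices a b β N ω).image fun n => j (β, n)
    have hF : F.card = (freeIndices a b β N ω).card :=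
      Finset.card_image_of_injective _ fun n n' h => (Prod.ext_iff.1 (hj h)).2
    let T : Set K := {k | ∃ i : L × ℕ, i.1 < β ∧ j i = k}
    have hTF : Disjoint T (F : Set K) := by
      rw [Set.disjoint_left]
      rintro _ ⟨i, hi, rfl⟩ hk
      obtain ⟨n, -, hn⟩ := Finset.mem_image.1 (Finset.mem_coe.1 hk)
      rw [← hj hn] at hi
      exact lt_irrefl _ hi
    have hmeas : MeasurableSet[⨆ i ∈ T, MeasurableSpace.comap (fun x : K → Bool => x i)
        inferInstance] {x | past β (W (ω, x)) ∈ H} := by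
      have h1 : Measurable[⨆ i ∈ T, MeasurableSpace.comap (fun x : K → Bool => x i)
          inferInstance] fun x => past β (W (ω, x)) := by
        refine @measurable_pi_lambda _ _ _ (_) _ _ fun γ => ?_
        refine (measurable_embeddingReal (ℕ → Bool)).comp ?_
        refine @measurable_pi_lambda _ _ _ (_) _ _ fun n => ?_
        have h2 : Measurable fun c : Bool => decide (ω ∈ a (γ, n) ∨ ω ∈ b (γ, n) ∧ c = true) :=
          measurable_of_countable _
        exact h2.comp ((comap_measurable fun x : K → Bool => x (j (γ, n))).mono
          (le_iSup₂ (f := fun i (_ : i ∈ T) => MeasurableSpace.comap (fun x : K → Bool => x i)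
            inferInstance) (j (γ, n)) ⟨(γ, n), γ.2, rfl⟩) le_rfl)
      exact h1 hH
    have hsub : Prod.mk ω ⁻¹' (W ⁻¹' ((fun x => (past β x, x β)) ⁻¹' (H ×ˢ (q ⁻¹' {s})))) ⊆
        {x | past β (W (ω, x)) ∈ H} ∩ {x | ∀ k ∈ F, x k = s' k} := by
      rintro x ⟨hx, hxs⟩
      refine ⟨hx, fun k hk => ?_⟩
      obtain ⟨n, hn, rfl⟩ := Finset.mem_image.1 hk
      obtain ⟨hnN, hnb, hna⟩ := Finset.mem_filter.1 hn
      have h1 : q (W (ω, x) β) = s := hxs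
      have h2 : q (W (ω, x) β) = fun k : Fin N => fillIntervals a b j (ω, x) (β, k) :=
        congrFun hqG fun n => fillIntervals a b j (ω, x) (β, n)
      have h3 := congrFun (h2.symm.trans h1) ⟨n, Finset.mem_range.1 hnN⟩
      rw [hs' ⟨n, Finset.mem_range.1 hnN⟩, ← h3]
      simp [fillIntervals, hnb, hna]
    calc _ ≤ _ := measure_mono hsub
      _ = coinMeasure K {x | past β (W (ω, x)) ∈ H} * 2⁻¹ ^ F.card :=
        coinMeasure_inter_eq hmeas F hTF s'
      _ = _ := by rw [hF, mul_comm]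

/-- The law of intervals filled by coin tosses is equivalent to a product of uniform laws. -/
theorem exists_measurePreserving_uniform [WellFoundedLT L] (hj : Function.Injective j)
    (ha : ∀ i, MeasurableSet (a i)) (hb : ∀ i, MeasurableSet (b i))
    (hfreq : ∀ β, ∀ᵐ ω ∂P, ∃ᶠ n in Filter.atTop, ω ∈ b (β, n) \ a (β, n)) :
    ∃ f : (L × ℕ → Bool) → L → ℝ,
      MeasurePreserving f ((P.prod (coinMeasure K)).map (fillIntervals a b j))
        (Measure.infinitePi fun _ : L => uniformMeasure) ∧
      EssentiallyInvertible ((P.prod (coinMeasure K)).map (fillIntervals a b j)) f := by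
  have hfill := measurable_fillIntervals (j := j) ha hb
  let R := (P.prod (coinMeasure K)).map (encodeBlocks ∘ fillIntervals a b j)
  have : IsProbabilityMeasure R :=
    Measure.isProbabilityMeasure_map (measurable_encodeBlocks.comp hfill).aemeasurable
  have hdiff : ∀ β, IsConditionallyDiffuse (pastLaw R β) := fun β =>
    isConditionallyDiffuse_encodeBlocks hj ha hb (hfreq β)
  have hmp : MeasurePreserving encodeBlocks
      ((P.prod (coinMeasure K)).map (fillIntervals a b j)) R :=
    ⟨measurable_encodeBlocks, Measure.map_map measurable_encodeBlocks hfill⟩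
  refine ⟨chainTransform R ∘ encodeBlocks,
    MeasurePreserving.comp ⟨measurable_chainTransform, map_chainTransform hdiff⟩ hmp, ?_⟩
  refine EssentiallyInvertible.comp
    (fun s hs => exists_ae_eq_chainTransform_preimage hdiff hs) (fun s hs => ?_) hmp
  obtain ⟨t, ht, rfl⟩ := exists_eq_encodeBlocks_preimage hs
  exact ⟨t, ht, Filter.EventuallyEq.rfl⟩

/-- The coin-tossing measure itself is equivalent to a product of uniform laws. -/
theorem exists_measurePreserving_uniform_coinMeasure [WellFoundedLT L] [Infinite L] :
    ∃ f : (L → Bool) → L → ℝ,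
      MeasurePreserving f (coinMeasure L) (Measure.infinitePi fun _ : L => uniformMeasure) ∧
      EssentiallyInvertible (coinMeasure L) f := by
  have hcard : #(L × ℕ) = #L := by
    rw [mk_prod, lift_uzero, mk_nat, lift_aleph0, mul_aleph0_eq (aleph0_le_mk L)]
  obtain ⟨e⟩ := Cardinal.eq.1 hcard
  obtain ⟨f, hf, hinv⟩ := exists_measurePreserving_uniform (L := L) (K := L)
    (P := Measure.dirac PUnit.unit.{u + 1}) (a := fun _ => ∅) (b := fun _ => univ) e.injective
    (fun _ => MeasurableSet.empty) (fun _ => MeasurableSet.univ)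
    (fun β => Filter.Eventually.of_forall fun ω =>
      (Filter.Eventually.of_forall fun n => ⟨trivial, id⟩).frequently)
  let g : (L → Bool) → L × ℕ → Bool := fun x i => x (e i)
  have hg : Measurable g := by fun_prop
  have hfill : fillIntervals (fun _ => ∅) (fun _ => Set.univ) e =
      g ∘ (Prod.snd : PUnit.{u + 1} × (L → Bool) → L → Bool) := by
    funext ω i
    simp [fillIntervals, g]
  have hlaw : (((Measure.dirac PUnit.unit.{u + 1}).prod (coinMeasure L)).map
      (fillIntervals (fun _ => ∅) (fun _ => Set.univ) e)) = (coinMeasure L).map g := by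
    rw [hfill, ← Measure.map_map hg measurable_snd]
    congr 1
    exact measurePreserving_snd.map_eq
  rw [hlaw] at hf hinv
  have hmp : MeasurePreserving g (coinMeasure L) ((coinMeasure L).map g) := ⟨hg, rfl⟩
  refine ⟨f ∘ g, hf.comp hmp, hinv.comp (fun s hs => ?_) hmp⟩
  refine ⟨(fun y l => y (e.symm l)) ⁻¹' s, (by fun_prop : Measurable
    fun (y : L × ℕ → Bool) l => y (e.symm l)) hs, Filter.EventuallyEq.of_eq ?_⟩
  ext x
  change x ∈ s ↔ (fun l => x (e (e.symm l))) ∈ s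
  simp

end Blocks

/-! ### Regular Borel measures on closed subspaces of the cube -/

section Cube

variable {I : Type u}

/-- The algebra of subsets of the cube that depend on finitely many coordinates. -/
def cylinderAlgebra (I : Type u) : BooleanSubalgebra (Set (I → Bool)) :=
  BooleanSubalgebra.closure (range fun i => {x | x i = true})

theorem isClopen_of_mem_cylinderAlgebra {C : Set (I → Bool)} (hC : C ∈ cylinderAlgebra I) :
    IsClopen C := by
  induction hC using BooleanSubalgebra.closure_bot_sup_induction with
  | mem x hx =>
    obtain ⟨i, rfl⟩ := hx
    exact (isClopen_discrete {true}).preimage (continuous_apply i)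
  | bot => exact isClopen_empty
  | sup x _ y _ hx hy => exact hx.union hy
  | compl x _ hx => exact hx.compl

theorem measurableSet_of_mem_cylinderAlgebra {C : Set (I → Bool)} (hC : C ∈ cylinderAlgebra I) :
    MeasurableSet C := by
  induction hC using BooleanSubalgebra.closure_bot_sup_induction with
  | mem x hx =>
    obtain ⟨i, rfl⟩ := hx
    change MeasurableSet ((fun x : I → Bool => x i) ⁻¹' {true})
    exact measurable_pi_apply i (measurableSet_singleton true)
  | bot => exact MeasurableSet.empty
  | sup x _ y _ hx hy => exact hx.union hy
  | compl x _ hx => exact hx.compl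

theorem generateFrom_cylinderAlgebra :
    (MeasurableSpace.pi : MeasurableSpace (I → Bool)) =
      MeasurableSpace.generateFrom (cylinderAlgebra I : Set (Set (I → Bool))) := by
  refine le_antisymm ?_ (MeasurableSpace.generateFrom_le fun C hC =>
    measurableSet_of_mem_cylinderAlgebra hC)
  refine iSup_le fun i => Measurable.comap_le ?_
  refine @measurable_to_bool _ (MeasurableSpace.generateFrom _) _
    (MeasurableSpace.measurableSet_generateFrom ?_)
  exact BooleanSubalgebra.subset_closure ⟨i, rfl⟩

theorem setOf_eqOn_mem_cylinderAlgebra (F : Finset I) (x : I → Bool) :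
    {y : I → Bool | ∀ i ∈ F, y i = x i} ∈ cylinderAlgebra I := by
  classical
  induction F using Finset.induction_on with
  | empty => simpa using (cylinderAlgebra I).top_mem
  | insert i F _ ih =>
    have h : {y : I → Bool | y i = x i} ∈ cylinderAlgebra I := by
      have h0 : {y : I → Bool | y i = true} ∈ cylinderAlgebra I :=
        BooleanSubalgebra.subset_closure ⟨i, rfl⟩
      cases x i
      · convert BooleanSubalgebra.compl_mem h0 using 1
        ext y; simp
      · exact h0
    convert BooleanSubalgebra.inf_mem h ih using 1
    ext y; simp

/-- A compact set can be separated from the complement of an open set by a set that depends on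
finitely many coordinates. -/
theorem exists_mem_cylinderAlgebra_between {Z O : Set (I → Bool)} (hZ : IsCompact Z)
    (hO : IsOpen O) (hZO : Z ⊆ O) : ∃ C ∈ cylinderAlgebra I, Z ⊆ C ∧ C ⊆ O := by
  refine hZ.induction_on (p := fun s => ∃ C ∈ cylinderAlgebra I, s ⊆ C ∧ C ⊆ O)
    ⟨∅, BooleanSubalgebra.bot_mem, Subset.rfl, empty_subset _⟩ ?_ ?_ ?_
  · rintro s t hst ⟨C, hC, htC, hCO⟩
    exact ⟨C, hC, hst.trans htC, hCO⟩
  · rintro s t ⟨C, hC, hsC, hCO⟩ ⟨D, hD, htD, hDO⟩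
    exact ⟨C ∪ D, BooleanSubalgebra.sup_mem hC hD, union_subset_union hsC htD,
      union_subset hCO hDO⟩
  · intro x hx
    obtain ⟨F, v, hv, hvO⟩ := isOpen_pi_iff.1 hO x (hZO hx)
    have hC := setOf_eqOn_mem_cylinderAlgebra F x
    refine ⟨_, mem_nhdsWithin_of_mem_nhds
      ((isClopen_of_mem_cylinderAlgebra hC).isOpen.mem_nhds fun i _ => rfl), _, hC, Subset.rfl, ?_⟩
    intro y hy
    refine hvO fun i hi => ?_
    rw [hy i hi]
    exact (hv i hi).2

/-- Continuous functions on the cube are measurable for the product σ-algebra, not only for the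
Borel σ-algebra. -/
theorem measurable_of_continuous_cube {g : (I → Bool) → ℝ} (hg : Continuous g) : Measurable g := by
  refine measurable_of_isClosed fun Z hZ => ?_
  have hcomp : IsCompact (g ⁻¹' Z) := (hZ.preimage hg).isCompact
  have hsub : ∀ n : ℕ, Z ⊆ Metric.thickening ((n : ℝ) + 1)⁻¹ Z := fun n =>
    Metric.self_subset_thickening (by positivity) Z
  choose C hC hZC hCO using fun n : ℕ => exists_mem_cylinderAlgebra_between hcomp
    (Metric.isOpen_thickening.preimage hg) (preimage_mono (hsub n))
  have : g ⁻¹' Z = ⋂ n, C n := by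
    refine Subset.antisymm (subset_iInter hZC) fun x hx => ?_
    rw [mem_preimage, ← hZ.closure_eq, Metric.closure_eq_iInter_thickening]
    refine mem_iInter₂.2 fun δ hδ => ?_
    obtain ⟨n, hn⟩ := exists_nat_one_div_lt hδ
    rw [one_div] at hn
    exact Metric.thickening_mono hn.le Z (hCO n (mem_iInter.1 hx n))
  rw [this]
  exact MeasurableSet.iInter fun n => measurableSet_of_mem_cylinderAlgebra (hC n)

/-- The cube `{0,1}^I` with its Borel σ-algebra, which is larger than the product σ-algebra if `I`
is uncountable. -/
def BorelCube (I : Type u) : Type u := I → Bool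

namespace BorelCube

instance : TopologicalSpace (BorelCube I) := inferInstanceAs (TopologicalSpace (I → Bool))
instance : CompactSpace (BorelCube I) := inferInstanceAs (CompactSpace (I → Bool))
instance : T2Space (BorelCube I) := inferInstanceAs (T2Space (I → Bool))
instance : TotallyDisconnectedSpace (BorelCube I) :=
  inferInstanceAs (TotallyDisconnectedSpace (I → Bool))
instance : MeasurableSpace (BorelCube I) := borel _
instance : BorelSpace (BorelCube I) := ⟨rfl⟩

/-- The point of the cube, forgetting the change of σ-algebra. -/
def val (x : BorelCube I) : I → Bool := x

theorem continuous_val : Continuous (val : BorelCube I → I → Bool) := continuous_id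

theorem isClosedEmbedding_val : Topology.IsClosedEmbedding (val : BorelCube I → I → Bool) :=
  Topology.IsClosedEmbedding.id

theorem measurable_val : Measurable (val : BorelCube I → I → Bool) :=
  measurable_pi_lambda _ fun i => ((continuous_apply i).comp continuous_val).measurable

/-- By the Riesz representation theorem a probability measure on the product σ-algebra extends to
a regular Borel measure. -/
theorem exists_regular_extension (Q : Measure (I → Bool)) [IsProbabilityMeasure Q] :
    ∃ m : Measure (BorelCube I), m.Regular ∧ IsFiniteMeasure m ∧
      ∀ C ∈ cylinderAlgebra I, m (val ⁻¹' C) = Q C := by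
  have hmeas : ∀ g : CompactlySupportedContinuousMap (BorelCube I) ℝ,
      Measurable fun x : I → Bool => g x := fun g =>
    measurable_of_continuous_cube (I := I) (map_continuous g)
  have hint : ∀ g : CompactlySupportedContinuousMap (BorelCube I) ℝ,
      Integrable (fun x : I → Bool => g x) Q := by
    intro g
    obtain ⟨c, hc⟩ := isCompact_univ.exists_bound_of_continuousOn (map_continuous g).continuousOn
    exact Integrable.of_bound (hmeas g).aestronglyMeasurable c
      (Filter.Eventually.of_forall fun x => hc x trivial)
  let Λ : CompactlySupportedContinuousMap (BorelCube I) ℝ →ₚ[ℝ] ℝ :=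
    { toFun := fun g => ∫ x, g x ∂Q
      map_add' := fun g g' => integral_add (hint g) (hint g')
      map_smul' := fun c g => integral_smul c fun x => g x
      monotone' := fun g g' h => integral_mono (hint g) (hint g') h }
  refine ⟨RealRMK.rieszMeasure Λ, inferInstance, inferInstance, fun C hC => ?_⟩
  have hclopen : IsClopen (val ⁻¹' C : Set (BorelCube I)) :=
    (isClopen_of_mem_cylinderAlgebra hC).preimage continuous_val
  let g : CompactlySupportedContinuousMap (BorelCube I) ℝ :=
    { toFun := BoundedContinuousFunction.indicator (val ⁻¹' C) hclopen
      continuous_toFun := map_continuous _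
      hasCompactSupport' := HasCompactSupport.of_compactSpace _ }
  have h := RealRMK.integral_rieszMeasure Λ g
  have h1 : ∫ x, g x ∂(RealRMK.rieszMeasure Λ) = (RealRMK.rieszMeasure Λ).real (val ⁻¹' C) :=
    integral_indicator_one hclopen.isOpen.measurableSet
  have h2 : Λ g = Q.real C :=
    integral_indicator_one (measurableSet_of_mem_cylinderAlgebra hC)
  rw [h1, h2] at h
  exact (measureReal_eq_measureReal_iff).1 h

end BorelCube

/-- The support of a measure on the product σ-algebra of the cube. -/
def cubeSupport (Q : Measure (I → Bool)) : Set (BorelCube I) :=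
  {x | ∀ C ∈ cylinderAlgebra I, x.val ∈ C → Q C ≠ 0}

theorem isClosed_cubeSupport (Q : Measure (I → Bool)) : IsClosed (cubeSupport Q) := by
  refine isOpen_compl_iff.1 (isOpen_iff_forall_mem_open.2 fun x hx => ?_)
  simp only [cubeSupport, mem_compl_iff, mem_ofPred_eq, not_forall, not_not] at hx
  obtain ⟨C, hC, hxC, h0⟩ := hx
  exact ⟨BorelCube.val ⁻¹' C, fun y hy hy' => hy' C hC hy h0,
    (isClopen_of_mem_cylinderAlgebra hC).isOpen.preimage BorelCube.continuous_val, hxC⟩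

/-- Regularity is essential: the complement of the support is an uncountable union of null sets. -/
theorem measure_compl_cubeSupport {Q : Measure (I → Bool)} {m : Measure (BorelCube I)} [m.Regular]
    (hm : ∀ C ∈ cylinderAlgebra I, m (BorelCube.val ⁻¹' C) = Q C) : m (cubeSupport Q)ᶜ = 0 := by
  rw [(isClosed_cubeSupport Q).isOpen_compl.measure_eq_iSup_isCompact]
  simp only [ENNReal.iSup_eq_zero]
  refine fun Z hZ hZc => hZc.measure_zero_of_nhdsWithin fun x hx => ?_
  have hx' := hZ hx
  simp only [cubeSupport, mem_compl_iff, mem_ofPred_eq, not_forall, not_not] at hx'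
  obtain ⟨C, hC, hxC, h0⟩ := hx'
  exact ⟨_, mem_nhdsWithin_of_mem_nhds (((isClopen_of_mem_cylinderAlgebra hC).isOpen.preimage
    BorelCube.continuous_val).mem_nhds hxC), (hm C hC).trans h0⟩

/-- Every probability measure on the product σ-algebra of the cube is carried, up to null sets, by
a regular Borel measure on its support. -/
theorem exists_regular_measure_cubeSupport (Q : Measure (I → Bool)) [IsProbabilityMeasure Q] :
    ∃ m : Measure (cubeSupport Q), IsProbabilityMeasure m ∧ m.Regular ∧
      MeasurePreserving (fun x : cubeSupport Q => (x : BorelCube I).val) m Q ∧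
      EssentiallyInvertible m fun x : cubeSupport Q => (x : BorelCube I).val := by
  obtain ⟨M, hMr, hMf, hM⟩ := BorelCube.exists_regular_extension Q
  have hclosed := isClosed_cubeSupport Q
  have hemb : MeasurableEmbedding ((↑) : cubeSupport Q → BorelCube I) :=
    MeasurableEmbedding.subtype_coe hclosed.measurableSet
  have hcemb := hclosed.isClosedEmbedding_subtypeVal
  let m : Measure (cubeSupport Q) := M.comap (↑)
  have hval : Measurable fun x : cubeSupport Q => (x : BorelCube I).val :=
    BorelCube.measurable_val.comp measurable_subtype_coe
  have hmC : ∀ C ∈ cylinderAlgebra I,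
      m ((fun x : cubeSupport Q => (x : BorelCube I).val) ⁻¹' C) = Q C := by
    intro C hC
    rw [← hM C hC, hemb.comap_apply]
    change M ((↑) '' ((↑) ⁻¹' (BorelCube.val ⁻¹' C) : Set (cubeSupport Q))) = _
    rw [Subtype.image_preimage_coe]
    refine measure_congr ?_
    have hae : (cubeSupport Q : Set (BorelCube I)) =ᵐ[M] Set.univ :=
      Filter.eventuallyEq_univ.2 (mem_ae_iff.2 (measure_compl_cubeSupport hM))
    simpa using hae.inter (Filter.EventuallyEq.refl _ (BorelCube.val ⁻¹' C))
  have hmprob : IsProbabilityMeasure m := ⟨by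
    have := hmC _ (cylinderAlgebra I).top_mem
    simpa using this⟩
  have hmreg : m.Regular := by
    have h1 : m.OuterRegular := Measure.OuterRegular.comap' M continuous_subtype_val hemb
    exact
      { innerRegular := Measure.InnerRegularCompactLTTop.innerRegular.comap hemb
          (fun U hU => ⟨hemb.measurableSet_image.2 hU.measurableSet, measure_ne_top _ _⟩)
          (fun Z hZ hZc => hcemb.isInducing.isCompact_preimage' hZc hZ) }
  refine ⟨m, hmprob, hmreg, ⟨hval, ?_⟩, fun s hs => ?_⟩
  · have : IsProbabilityMeasure (m.map fun x : cubeSupport Q => (x : BorelCube I).val) :=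
      Measure.isProbabilityMeasure_map hval.aemeasurable
    refine ext_of_generate_finite _ generateFrom_cylinderAlgebra
      (fun C hC D hD _ => BooleanSubalgebra.inf_mem hC hD) (fun C hC => ?_) (by simp)
    rw [Measure.map_apply hval (measurableSet_of_mem_cylinderAlgebra hC), hmC C hC]
  · let ι : cubeSupport Q → I → Bool := fun x => (x : BorelCube I).val
    have hι : Topology.IsClosedEmbedding ι := BorelCube.isClosedEmbedding_val.comp hcemb
    -- by outer regularity and compactness, a closed set differs by a null set from a countable
    -- intersection of cylinder sets
    have hle : (inferInstance : MeasurableSpace (cubeSupport Q)) ≤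
        eventuallyMeasurableSpace (MeasurableSpace.comap ι inferInstance) (ae m) := by
      refine ((BorelSpace.measurable_eq (α := cubeSupport Q)).trans
        borel_eq_generateFrom_isClosed).le.trans ?_
      refine MeasurableSpace.generateFrom_le fun Z hZ => ?_
      have hU : ∀ n : ℕ, ∃ U, Z ⊆ U ∧ IsOpen U ∧ m U < m Z + (n + 1 : ℝ≥0∞)⁻¹ := fun n => by
        obtain ⟨U, hZU, hU, h⟩ := Z.exists_isOpen_lt_add (measure_ne_top m Z)
          (ε := (n + 1 : ℝ≥0∞)⁻¹) (by simp)
        exact ⟨U, hZU, hU, h⟩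
      choose U hZU hU hmU using hU
      choose O hO hOU using fun n => hι.isInducing.isOpen_iff.1 (hU n)
      have hZc : IsCompact (ι '' Z) :=
        (hι.isClosedMap Z hZ).isCompact
      choose C hC hZC hCO using fun n => exists_mem_cylinderAlgebra_between hZc (hO n)
        (image_subset_iff.2 ((hZU n).trans (hOU n).symm.subset))
      have hCm : MeasurableSet (⋂ n, C n) :=
        MeasurableSet.iInter fun n => measurableSet_of_mem_cylinderAlgebra (hC n)
      refine ⟨ι ⁻¹' ⋂ n, C n, ⟨_, hCm, rfl⟩, ?_⟩
      refine ae_eq_of_subset_of_measure_ge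
        (image_subset_iff.1 (subset_iInter hZC)) ?_ hZ.measurableSet.nullMeasurableSet
        (measure_ne_top _ _)
      refine ENNReal.le_of_forall_pos_le_add fun ε hε _ => ?_
      obtain ⟨n, hn⟩ := ENNReal.exists_inv_nat_lt (ENNReal.coe_pos.2 hε).ne'
      calc m (ι ⁻¹' ⋂ n, C n) ≤ m (U n) := measure_mono fun x hx => by
            rw [← hOU n]; exact hCO n (mem_iInter.1 hx n)
        _ ≤ m Z + (n + 1 : ℝ≥0∞)⁻¹ := (hmU n).le
        _ ≤ m Z + ε := by
          gcongr
          exact (ENNReal.inv_le_inv.2 le_self_add).trans hn.le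
    obtain ⟨_, ⟨t, ht, rfl⟩, hst⟩ := hle s hs
    exact ⟨t, ht, hst⟩

/-- Coordinate events of a continuous map from a closed subspace of the cube to another cube are
traces of sets that depend on finitely many coordinates. -/
theorem exists_cylinder_of_continuous {J : Type u} {X : Set (BorelCube I)} (hX : IsClosed X)
    {φ : X → J → Bool} (hφ : Continuous φ) (i : J) :
    ∃ C ∈ cylinderAlgebra I, ∀ x : X, φ x i = true ↔ (x : BorelCube I).val ∈ C := by
  have hι : Topology.IsClosedEmbedding fun x : X => (x : BorelCube I).val :=
    BorelCube.isClosedEmbedding_val.comp hX.isClosedEmbedding_subtypeVal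
  have hclopen : IsClopen {x | φ x i = true} :=
    (isClopen_discrete {true}).preimage ((continuous_apply i).comp hφ)
  obtain ⟨O, hO, hOφ⟩ := hι.isInducing.isOpen_iff.1 hclopen.isOpen
  obtain ⟨C, hC, hφC, hCO⟩ := exists_mem_cylinderAlgebra_between
    (hι.isClosedMap _ hclopen.isClosed).isCompact hO (image_subset_iff.2 hOφ.symm.subset)
  refine ⟨C, hC, fun x => ⟨fun hx => hφC ⟨x, hx, rfl⟩, fun hx => ?_⟩⟩
  have : x ∈ {x | φ x i = true} := by rw [← hOφ]; exact hCO hx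
  exact this

end Cube

/-! ### Blocks of intervals that cover a fixed set infinitely often -/

/-- Every type carries a well-order with small initial segments. -/
theorem exists_wellOrder_mk_Iio_lt (L : Type u) :
    ∃ _ : LinearOrder L, WellFoundedLT L ∧ ∀ β : L, #(Iio β) < #L := by
  obtain ⟨r, hr, h⟩ := exists_ord_eq L
  classical
  let := linearOrderOfSTO r
  have : WellFoundedLT L := ⟨hr.wf⟩
  exact ⟨inferInstance, this, fun β => mk_Iio_lt β h⟩

namespace Cardinal

variable {L : Type u}

theorem IsRegular.mk_iUnion_nat_lt {c : Cardinal.{u}} (hc : c.IsRegular) (hc' : ℵ₀ < c)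
    {t : ℕ → Set L} (ht : ∀ n, #(t n) < c) : #(⋃ n, t n) < c := by
  have h := (card_iUnion_lt_iff_forall_of_isRegular (t := fun n : ULift.{u} ℕ => t n.down) hc
    (by simpa using hc')).2 fun n => ht n.down
  have : (⋃ n, t n) = ⋃ n : ULift.{u} ℕ, t n.down := by
    ext x; simp
  rwa [this]

theorem IsRegular.mk_union_lt {c : Cardinal.{u}} (hc : c.IsRegular) {s t : Set L} (hs : #s < c)
    (ht : #t < c) : #↥(s ∪ t) < c :=
  (mk_union_le _ _).trans_lt (add_lt_of_lt hc.aleph0_le hs ht)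

theorem mk_range_nat_lt {c : Cardinal.{u}} (hc : ℵ₀ < c) (s : ℕ → L) : #(range s) < c :=
  (mk_le_aleph0_iff.2 (countable_range s).to_subtype).trans_lt hc

end Cardinal

section Blocks

variable {L Ω : Type u} [MeasurableSpace Ω] {P : Measure Ω} {c : L → Set Ω}

variable (P c) in
/-- The essential measure of the union of the `c α` with `α ∉ K`. -/
noncomputable def unionMeasure (K : Set L) : ℝ≥0∞ :=
  ⨆ s : {s : ℕ → L // ∀ n, s n ∉ K}, P (⋃ n, c (s.1 n))

theorem measure_iUnion_le_unionMeasure {K : Set L} {s : ℕ → L} (hs : ∀ n, s n ∉ K) :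
    P (⋃ n, c (s n)) ≤ unionMeasure P c K :=
  le_iSup (fun s : {s : ℕ → L // ∀ n, s n ∉ K} => P (⋃ n, c (s.1 n))) ⟨s, hs⟩

theorem unionMeasure_anti {K K' : Set L} (h : K ⊆ K') : unionMeasure P c K' ≤ unionMeasure P c K :=
  iSup_le fun s => measure_iUnion_le_unionMeasure fun n hn => s.2 n (h hn)

variable [IsFiniteMeasure P]

/-- The supremum that defines `unionMeasure` is attained. -/
theorem exists_measure_iUnion_eq_unionMeasure {K : Set L} (hK : Kᶜ.Nonempty) :
    ∃ s : ℕ → L, (∀ n, s n ∉ K) ∧ P (⋃ n, c (s n)) = unionMeasure P c K := by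
  have hne : Nonempty {s : ℕ → L // ∀ n, s n ∉ K} := ⟨⟨fun _ => hK.some, fun _ => hK.some_mem⟩⟩
  have hex : ∀ k : ℕ, ∃ s : {s : ℕ → L // ∀ n, s n ∉ K},
      unionMeasure P c K ≤ P (⋃ n, c (s.1 n)) + (k + 1 : ℝ≥0∞)⁻¹ := by
    intro k
    by_contra hcon
    push Not at hcon
    have h1 : unionMeasure P c K + (k + 1 : ℝ≥0∞)⁻¹ ≤ unionMeasure P c K := by
      conv_lhs => rw [unionMeasure, ENNReal.iSup_add]
      exact iSup_le fun s => (hcon s).le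
    have hfin : unionMeasure P c K ≠ ∞ :=
      ((iSup_le fun s => measure_mono (subset_univ _)).trans_lt (measure_lt_top P Set.univ)).ne
    exact (ENNReal.lt_add_right hfin (by simp)).not_ge h1
  choose s hs using hex
  let r : ℕ → L := fun n => (s n.unpair.1).1 n.unpair.2
  have hr : ∀ n, r n ∉ K := fun n => (s n.unpair.1).2 _
  refine ⟨r, hr, le_antisymm (measure_iUnion_le_unionMeasure hr) ?_⟩
  refine ENNReal.le_of_forall_pos_le_add fun ε hε _ => ?_
  obtain ⟨k, hk⟩ := ENNReal.exists_inv_nat_lt (ENNReal.coe_pos.2 hε).ne'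
  refine (hs k).trans (add_le_add (measure_mono ?_)
    ((ENNReal.inv_le_inv.2 le_self_add).trans hk.le))
  refine iUnion_subset fun n => ?_
  have : (s k).1 n = r (Nat.pair k n) := by simp [r]
  rw [this]
  exact subset_iUnion (fun n => c (r n)) _

/-- There is a non-null set that is still covered by countably many of the sets `c α` after fewer
than `#L` of them have been removed: a union of them that avoids the set `K₀` where
`unionMeasure` reaches its infimum. -/
theorem exists_essential_union (hL : (#L).IsRegular) (hL' : ℵ₀ < #L)
    (hpos : ∀ α, P (c α) ≠ 0) (hc : ∀ α, MeasurableSet (c α)) :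
    ∃ E, MeasurableSet E ∧ P E ≠ 0 ∧ ∀ K : Set L, #K < #L →
      ∃ s : ℕ → L, (∀ n, s n ∉ K) ∧ P (E \ ⋃ n, c (s n)) = 0 := by
  have hcompl : ∀ K : Set L, #K < #L → Kᶜ.Nonempty := by
    intro K hK
    by_contra h
    rw [not_nonempty_iff_eq_empty, compl_empty_iff] at h
    rw [h, mk_univ] at hK
    exact lt_irrefl _ hK
  let small := {K : Set L // #K < #L}
  have hne : Nonempty small := ⟨⟨∅, by
    rw [mk_eq_zero]; exact (aleph0_pos.trans hL')⟩⟩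
  let μ₀ := ⨅ K : small, unionMeasure P c K.1
  have hex : ∀ k : ℕ, ∃ K : small, unionMeasure P c K.1 ≤ μ₀ + (k + 1 : ℝ≥0∞)⁻¹ := by
    intro k
    have hfin : μ₀ ≠ ∞ := ((iInf_le _ hne.some).trans_lt
      ((iSup_le fun s => measure_mono (subset_univ _)).trans_lt
        (measure_lt_top P Set.univ))).ne
    obtain ⟨K, hK⟩ := iInf_lt_iff.1 (ENNReal.lt_add_right hfin
      (b := (k + 1 : ℝ≥0∞)⁻¹) (by simp))
    exact ⟨K, hK.le⟩
  choose K hK using hex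
  let K₀ : Set L := ⋃ k, (K k).1
  have hK₀ : #K₀ < #L := hL.mk_iUnion_nat_lt hL' fun k => (K k).2
  have hK₀' : unionMeasure P c K₀ ≤ μ₀ := by
    refine ENNReal.le_of_forall_pos_le_add fun ε hε _ => ?_
    obtain ⟨k, hk⟩ := ENNReal.exists_inv_nat_lt (ENNReal.coe_pos.2 hε).ne'
    calc unionMeasure P c K₀ ≤ unionMeasure P c (K k).1 :=
          unionMeasure_anti (subset_iUnion (fun k => (K k).1) k)
      _ ≤ μ₀ + (k + 1 : ℝ≥0∞)⁻¹ := hK k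
      _ ≤ μ₀ + ε := by gcongr; exact (ENNReal.inv_le_inv.2 le_self_add).trans hk.le
  obtain ⟨s₀, hs₀, hs₀P⟩ := exists_measure_iUnion_eq_unionMeasure (P := P) (c := c)
    (hcompl K₀ hK₀)
  have hEm : ∀ s : ℕ → L, MeasurableSet (⋃ n, c (s n)) := fun s =>
    MeasurableSet.iUnion fun n => hc (s n)
  refine ⟨⋃ n, c (s₀ n), hEm s₀, fun h0 => hpos (s₀ 0) (measure_mono_null
    (subset_iUnion (fun n => c (s₀ n)) 0) h0), fun K hK => ?_⟩
  have hKK := hL.mk_union_lt hK hK₀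
  obtain ⟨s, hs, hsP⟩ := exists_measure_iUnion_eq_unionMeasure (P := P) (c := c)
    (hcompl _ hKK)
  refine ⟨s, fun n hn => hs n (Or.inl hn), ?_⟩
  -- the combined sequence avoids `K₀`, hence its union has the same measure as that of `s`
  let r : ℕ → L := fun n => if n % 2 = 0 then s (n / 2) else s₀ (n / 2)
  have hr : ∀ n, r n ∉ K₀ := fun n => by
    simp only [r]
    split_ifs
    · exact fun hn => hs _ (Or.inr hn)
    · exact hs₀ _
  have hsub : (⋃ n, c (s₀ n)) ∪ ⋃ n, c (s n) ⊆ ⋃ n, c (r n) := by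
    refine union_subset (iUnion_subset fun n => ?_) (iUnion_subset fun n => ?_)
    · have : s₀ n = r (2 * n + 1) := by
        have h1 : (2 * n + 1) % 2 ≠ 0 := by omega
        have h2 : (2 * n + 1) / 2 = n := by omega
        simp only [r, if_neg h1, h2]
      rw [this]
      exact subset_iUnion (fun n => c (r n)) _
    · have : s n = r (2 * n) := by simp [r]
      rw [this]
      exact subset_iUnion (fun n => c (r n)) _
  have hle : P ((⋃ n, c (s₀ n)) ∪ ⋃ n, c (s n)) ≤ P (⋃ n, c (s n)) :=
    calc P ((⋃ n, c (s₀ n)) ∪ ⋃ n, c (s n)) ≤ P (⋃ n, c (r n)) := measure_mono hsub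
      _ ≤ unionMeasure P c K₀ := measure_iUnion_le_unionMeasure hr
      _ ≤ μ₀ := hK₀'
      _ ≤ unionMeasure P c (K ∪ K₀) := iInf_le (fun K : small => unionMeasure P c K.1) ⟨_, hKK⟩
      _ = P (⋃ n, c (s n)) := hsP.symm
  rw [← union_sdiff_right, measure_sdiff subset_union_right (hEm s).nullMeasurableSet
    (measure_ne_top _ _)]
  exact tsub_eq_zero_of_le hle

/-- There are disjoint countable blocks, as many as there are sets `c α`, all of which cover the
same non-null set infinitely often. -/
theorem exists_blocks (hL : (#L).IsRegular) (hL' : ℵ₀ < #L)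
    (hpos : ∀ α, P (c α) ≠ 0) (hc : ∀ α, MeasurableSet (c α)) :
    ∃ E, MeasurableSet E ∧ P E ≠ 0 ∧ ∃ j : L × ℕ → L, Function.Injective j ∧
      ∀ β, ∀ᵐ ω ∂P, ω ∈ E → ∃ᶠ n in Filter.atTop, ω ∈ c (j (β, n)) := by
  obtain ⟨E, hE, hE0, hcov⟩ := exists_essential_union (P := P) hL hL' hpos hc
  refine ⟨E, hE, hE0, ?_⟩
  let small := {K : Set L // #K < #L}
  choose s hsK hsE using fun K : small => hcov K.1 K.2
  have block : ∀ K : small, ∃ g : ℕ → L, Function.Injective g ∧ (∀ n, g n ∉ K.1) ∧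
      ∀ᵐ ω ∂P, ω ∈ E → ∃ᶠ n in Filter.atTop, ω ∈ c (g n) := by
    intro K
    let next : small → small := fun K =>
      ⟨K.1 ∪ range (s K), hL.mk_union_lt K.2 (mk_range_nat_lt hL' _)⟩
    let T : ℕ → small := fun n => next^[n] K
    have hT : ∀ n, (T (n + 1)).1 = (T n).1 ∪ range (s (T n)) := fun n => by
      simp only [T, Function.iterate_succ_apply', next]
    have hmono : Monotone fun n => (T n).1 := monotone_nat_of_le_succ fun n => by
      change (T n).1 ⊆ (T (n + 1)).1
      rw [hT]; exact subset_union_left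
    -- members of different rounds are different
    have hround : ∀ {k k' n n' : ℕ}, s (T k) n = s (T k') n' → k = k' := by
      have aux : ∀ {k k' n n' : ℕ}, k < k' → s (T k) n ≠ s (T k') n' := by
        intro k k' n n' hk h
        refine hsK (T k') n' (h ▸ hmono (Nat.succ_le_of_lt hk) ?_)
        change s (T k) n ∈ (T (k + 1)).1
        rw [hT]
        exact Or.inr ⟨n, rfl⟩
      intro k k' n n' h
      rcases lt_trichotomy k k' with hk | hk | hk
      exacts [(aux hk h).elim, hk, (aux hk h.symm).elim]
    let A : Set L := ⋃ k, range (s (T k))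
    have hAc : A.Countable := countable_iUnion fun k => countable_range _
    have hAi : A.Infinite := infinite_of_injective_forall_mem (f := fun k => s (T k) 0)
      (fun k k' h => hround h) fun k => mem_iUnion.2 ⟨k, 0, rfl⟩
    have := hAc.to_subtype
    have := hAi.to_subtype
    obtain ⟨e⟩ : Nonempty (ℕ ≃ A) := nonempty_equiv_of_countable
    refine ⟨fun n => e n, Subtype.val_injective.comp e.injective, fun n hn => ?_, ?_⟩
    · obtain ⟨k, m, hm⟩ := mem_iUnion.1 (e n).2
      refine hsK (T k) m ?_
      rw [hm]
      exact hmono (Nat.zero_le k) hn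
    · have hall : ∀ᵐ ω ∂P, ∀ k, ω ∉ E \ ⋃ n, c (s (T k) n) :=
        ae_all_iff.2 fun k => measure_eq_zero_iff_ae_notMem.1 (hsE (T k))
      filter_upwards [hall] with ω hω hωE
      have h1 : ∀ k, ∃ n, ω ∈ c (s (T k) n) := fun k => by
        by_contra hcon
        exact hω k ⟨hωE, fun hmem => hcon (mem_iUnion.1 hmem)⟩
      choose n hn using h1
      rw [Nat.frequently_atTop_iff_infinite]
      refine infinite_of_injective_forall_mem
        (f := fun k => e.symm ⟨s (T k) (n k), mem_iUnion.2 ⟨k, n k, rfl⟩⟩) ?_ fun k => ?_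
      · intro k k' h
        exact hround (congrArg Subtype.val (e.symm.injective h))
      · simpa using hn k
  choose g hginj hgK hgE using block
  obtain ⟨_, hwf, hIio⟩ := exists_wellOrder_mk_Iio_lt L
  have used : ∀ (β : L) (G : Iio β → ℕ → L), #(⋃ γ, range (G γ) : Set L) < #L := fun β G =>
    (card_iUnion_lt_iff_forall_of_isRegular hL (hIio β)).2 fun γ => mk_range_nat_lt hL' _
  let G : L → ℕ → L := WellFoundedLT.fix fun β G =>
    g ⟨⋃ γ : Iio β, range (G γ.1 γ.2), used β fun γ => G γ.1 γ.2⟩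
  have hG : ∀ β, G β = g ⟨⋃ γ : Iio β, range (G γ), used β fun γ => G γ⟩ := fun β =>
    WellFoundedLT.fix_eq _ β
  have hdisj : ∀ {β γ : L} {n m : ℕ}, γ < β → G β n ≠ G γ m := by
    intro β γ n m hγ h
    rw [hG β] at h
    exact hgK ⟨⋃ γ : Iio β, range (G γ), used β fun γ => G γ⟩ n
      (mem_iUnion.2 ⟨⟨γ, hγ⟩, m, h.symm⟩)
  refine ⟨fun i => G i.1 i.2, ?_, fun β => ?_⟩
  · rintro ⟨β, n⟩ ⟨γ, m⟩ h
    dsimp only at h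
    rcases lt_trichotomy β γ with hlt | rfl | hlt
    · exact (hdisj hlt h.symm).elim
    · rw [hG β] at h
      rw [hginj _ h]
    · exact (hdisj hlt h).elim
  · dsimp only
    rw [hG β]
    exact hgE _

end Blocks

/-! ### Separated families and the dimension of subalgebras of the Maharam algebra -/

section Separation

variable {L : Type u}

/-- An element that does not depend on the coin `k` is far from every element that does. -/
theorem leb_symmDiff_flipCoin_le {k : L} {z y : MaharamAlgebra L}
    (hy : MeasureAlgebra.pullback (measurePreserving_flipCoin k) y = y) :
    MeasureAlgebra.leb (z ∆ MeasureAlgebra.pullback (measurePreserving_flipCoin k) z) ≤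
      2 * MeasureAlgebra.leb (z ∆ y) := by
  have h := MeasureAlgebra.leb_pullback (measurePreserving_flipCoin k) (z ∆ y)
  rw [map_symmDiff', hy] at h
  refine (MeasureAlgebra.leb_symmDiff_le z y _).trans ?_
  rw [symmDiff_comm y, h, two_mul]

theorem pullback_flipCoin_gen_self (k : L) :
    MeasureAlgebra.pullback (measurePreserving_flipCoin k) (MaharamAlgebra.gen k) =
      (MaharamAlgebra.gen k)ᶜ := by
  refine congrArg (MeasureAlgebra.mk _) (Subtype.ext ?_)
  ext x
  change flipCoin k x k = true ↔ ¬ x k = true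
  simp [flipCoin]

theorem pullback_flipCoin_gen_of_ne {k l : L} (h : l ≠ k) :
    MeasureAlgebra.pullback (measurePreserving_flipCoin k) (MaharamAlgebra.gen l) =
      MaharamAlgebra.gen l := by
  refine congrArg (MeasureAlgebra.mk _) (Subtype.ext ?_)
  ext x
  change flipCoin k x l = true ↔ x l = true
  simp [flipCoin, h]

theorem pullback_flipCoin_pullback {K : Type u} {j : K → L} (hj : Function.Injective j) {k : L}
    (h : ∀ i, j i ≠ k) (p : MaharamAlgebra K) :
    MeasureAlgebra.pullback (measurePreserving_flipCoin k)
        (MeasureAlgebra.pullback (measurePreserving_coinMeasure_comp hj) p) =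
      MeasureAlgebra.pullback (measurePreserving_coinMeasure_comp hj) p := by
  induction p using MeasureAlgebra.ind with
  | h s =>
    refine congrArg (MeasureAlgebra.mk _) (Subtype.ext ?_)
    ext x
    change (fun i => flipCoin k x (j i)) ∈ s.1 ↔ (fun i => x (j i)) ∈ s.1
    have : (fun i => flipCoin k x (j i)) = fun i => x (j i) := by
      funext i; simp [flipCoin, h]
    rw [this]

theorem half_le_leb_gen_symmDiff_gen {k l : L} (h : k ≠ l) :
    2⁻¹ ≤ MeasureAlgebra.leb (MaharamAlgebra.gen k ∆ MaharamAlgebra.gen l) := by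
  have h1 := leb_symmDiff_flipCoin_le (z := MaharamAlgebra.gen k)
    (pullback_flipCoin_gen_of_ne (k := k) h.symm)
  rw [pullback_flipCoin_gen_self, symmDiff_compl_self] at h1
  have h2 : MeasureAlgebra.leb (⊤ : MaharamAlgebra L) = 1 := measure_univ (μ := coinMeasure L)
  rw [h2] at h1
  rw [← one_div, ENNReal.div_le_iff_le_mul (by simp) (by simp), mul_comm]
  exact h1

/-- A measure algebra that is isomorphic to the Maharam algebra of dimension `#L` has dimension
`#L`. -/
theorem dimension_top_eq {Ω : Type u} [MeasurableSpace Ω] {m : Measure Ω} (hL : ℵ₀ < #L)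
    (e : MeasureAlgebra m ≃o MaharamAlgebra L)
    (he : ∀ a, MeasureAlgebra.leb (e a) = MeasureAlgebra.leb a) :
    MeasureAlgebra.dimension (⊤ : BooleanSubalgebra (MeasureAlgebra m)) = #L := by
  have hgen : (MeasurableSpace.pi : MeasurableSpace (L → Bool)) =
      MeasurableSpace.generateFrom (range fun i => {x : L → Bool | x i = true}) := by
    refine le_antisymm (iSup_le fun i => Measurable.comap_le ?_)
      (MeasurableSpace.generateFrom_le ?_)
    · exact @measurable_to_bool _ (MeasurableSpace.generateFrom _) _
        (MeasurableSpace.measurableSet_generateFrom ⟨i, rfl⟩)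
    · rintro _ ⟨i, rfl⟩
      exact measurable_pi_apply (X := fun _ : L => Bool) i (measurableSet_singleton true)
  have hdense := MeasureAlgebra.mem_metricClosure_of_generateFrom (m := coinMeasure L) hgen
    (D := range MaharamAlgebra.gen) (by rintro _ hs ⟨i, rfl⟩; exact ⟨i, rfl⟩)
  have hsymm : ∀ a b : MaharamAlgebra L,
      MeasureAlgebra.leb (e.symm a ∆ e.symm b) = MeasureAlgebra.leb (a ∆ b) := fun a b => by
    rw [← he, map_symmDiff, e.apply_symm_apply, e.apply_symm_apply]
  let D : Set (MeasureAlgebra m) := range fun i => e.symm (MaharamAlgebra.gen i)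
  have hclos : ∀ t ∈ BooleanSubalgebra.closure (range (MaharamAlgebra.gen (I := L))),
      e.symm t ∈ BooleanSubalgebra.closure D := by
    intro t ht
    induction ht using BooleanSubalgebra.closure_bot_sup_induction with
    | mem x hx =>
      obtain ⟨i, rfl⟩ := hx
      exact BooleanSubalgebra.subset_closure ⟨i, rfl⟩
    | bot => rw [map_bot]; exact BooleanSubalgebra.bot_mem
    | sup x _ y _ hx hy => rw [map_sup]; exact BooleanSubalgebra.sup_mem hx hy
    | compl x _ hx => rw [map_compl']; exact BooleanSubalgebra.compl_mem hx
  refine MeasureAlgebra.dimension_eq hL (D := D)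
    ((subset_univ _).trans (MeasureAlgebra.subset_metricClosure _)) (fun a _ ε hε => ?_)
    mk_range_le rfl (x := fun i => e.symm (MaharamAlgebra.gen i)) (fun _ => trivial)
    (ε := 2⁻¹) (by simp) fun k l hkl => ?_
  · obtain ⟨t, ht, hat⟩ := hdense (e a) ε hε
    refine ⟨e.symm t, hclos t ht, ?_⟩
    rwa [← hsymm, e.symm_apply_apply] at hat
  · rw [hsymm]
    exact half_le_leb_gen_symmDiff_gen hkl

end Separation

/-! ### From anti-independent intervals to large algebras without large independent sets -/

section Main

variable {L : Type u} {a b : L → MaharamAlgebra L} {j₁ j₂ : L → L}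

/-- The interval elements over the generators at the coordinates `j₂ i` are uniformly separated
on the intervals of large measure. -/
theorem leb_sdiff_le_leb_symmDiff_intervalElement (h₁ : Function.Injective j₁)
    (h₂ : Function.Injective j₂) (hd : ∀ k i, j₁ k ≠ j₂ i) {α β : L} (hαβ : α ≠ β) :
    MeasureAlgebra.leb (b α \ a α) ≤ 2 * MeasureAlgebra.leb
      (intervalElement (MeasureAlgebra.pullback (measurePreserving_coinMeasure_comp h₁)) a b
          (fun i => MaharamAlgebra.gen (j₂ i)) α ∆
        intervalElement (MeasureAlgebra.pullback (measurePreserving_coinMeasure_comp h₁)) a b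
          (fun i => MaharamAlgebra.gen (j₂ i)) β) := by
  set f := MeasureAlgebra.pullback (measurePreserving_coinMeasure_comp h₁)
  have hf : ∀ p, MeasureAlgebra.pullback (measurePreserving_flipCoin (j₂ α)) (f p) = f p :=
    pullback_flipCoin_pullback h₁ fun i => hd i α
  refine le_trans ?_ (leb_symmDiff_flipCoin_le (k := j₂ α) ?_)
  · rw [← MeasureAlgebra.leb_pullback (measurePreserving_coinMeasure_comp h₁)]
    refine MeasureAlgebra.leb_mono ?_
    simp only [intervalElement, map_sup, map_inf, hf, pullback_flipCoin_gen_self]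
    change f (b α \ a α) ≤ _
    rw [map_sdiff' f]
    -- inside `b α \ a α` the two elements follow a generator and its complement
    rw [symmDiff_eq_sup_sdiff_inf, ← sup_inf_left, ← inf_inf_distrib_left, inf_compl_self,
      inf_bot_eq, sup_bot_eq, ← sup_sup_distrib_left, ← inf_sup_left, sup_compl_eq_top, inf_top_eq,
      sup_sdiff_left_self]
  · simp only [intervalElement, map_sup, map_inf, hf,
      pullback_flipCoin_gen_of_ne (h₂.ne hαβ.symm)]

/-- The subalgebra generated by the interval elements over free generators. -/
noncomputable def intervalSubalgebra (h₁ : Function.Injective j₁) (a b : L → MaharamAlgebra L)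
    (j₂ : L → L) : BooleanSubalgebra (MaharamAlgebra L) :=
  BooleanSubalgebra.closure (range (intervalElement
    (MeasureAlgebra.pullback (measurePreserving_coinMeasure_comp h₁)) a b
    fun i => MaharamAlgebra.gen (j₂ i)))

theorem intervalElement_injective (h₁ : Function.Injective j₁) (h₂ : Function.Injective j₂)
    (hd : ∀ k i, j₁ k ≠ j₂ i) (hab : ∀ i, a i < b i) :
    Function.Injective (intervalElement
      (MeasureAlgebra.pullback (measurePreserving_coinMeasure_comp h₁)) a b
      fun i => MaharamAlgebra.gen (j₂ i)) := by
  intro α β h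
  by_contra hne
  have := leb_sdiff_le_leb_symmDiff_intervalElement (a := a) (b := b) h₁ h₂ hd hne
  rw [h, symmDiff_self, MeasureAlgebra.leb_bot, mul_zero, nonpos_iff_eq_zero,
    MeasureAlgebra.leb_eq_zero, sdiff_eq_bot_iff] at this
  exact (hab α).not_ge this

/-- Uncountably many proper intervals, in regular number, include equally many whose lengths are
bounded away from zero. -/
theorem exists_forall_le_leb_sdiff (hL : (#L).IsRegular) (hL' : ℵ₀ < #L)
    (hab : ∀ i, a i < b i) :
    ∃ ε : ℝ≥0∞, 0 < ε ∧ ∃ Y : Set L, #Y = #L ∧ ∀ i ∈ Y, ε ≤ MeasureAlgebra.leb (b i \ a i) := by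
  have hex : ∀ i, ∃ n : ℕ, (n : ℝ≥0∞)⁻¹ < MeasureAlgebra.leb (b i \ a i) := fun i =>
    ENNReal.exists_inv_nat_lt fun h => (hab i).not_ge
      (sdiff_eq_bot_iff.1 (MeasureAlgebra.leb_eq_zero.1 h))
  choose r hr using hex
  obtain ⟨n, hn⟩ := infinite_pigeonhole_card (fun i => (ULift.up (r i) : ULift.{u} ℕ)) #L le_rfl
    hL.aleph0_le (by rw [hL.cof_ord]; simpa using hL')
  refine ⟨(n.down : ℝ≥0∞)⁻¹, by simp, _, le_antisymm (mk_set_le _) hn, fun i hi => ?_⟩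
  have : r i = n.down := congrArg ULift.down hi
  rw [← this]
  exact (hr i).le

/-- The subalgebra generated by interval elements over free generators witnesses the failure of
the existence of large independent sets. -/
theorem isLargeWithoutIndependent_intervalSubalgebra (hL : (#L).IsRegular) (hL' : ℵ₀ < #L)
    (h₁ : Function.Injective j₁) (h₂ : Function.Injective j₂) (hd : ∀ k i, j₁ k ≠ j₂ i)
    (hab : ∀ i, a i < b i)
    (h : StronglyAntiIndependent #L a b ∨ MediumlyAntiIndependent #L a b) :
    IsLargeWithoutIndependent (intervalSubalgebra h₁ a b j₂) := by
  have hinj := intervalElement_injective h₁ h₂ hd hab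
  refine ⟨le_antisymm ?_ ?_, ?_, (isFreeOver_gen h₁ hd h₂).noIndependentSubset
    (MeasureAlgebra.pullback_injective _) h⟩
  · exact (BooleanSubalgebra.card_closure_le _).trans (max_le mk_range_le hL'.le)
  · rw [← mk_range_eq _ hinj]
    exact mk_le_mk_of_subset BooleanSubalgebra.subset_closure
  · obtain ⟨ε, hε, Y, hY, hYε⟩ := exists_forall_le_leb_sdiff hL hL' hab
    refine MeasureAlgebra.dimension_eq hL'
      (BooleanSubalgebra.subset_closure.trans (MeasureAlgebra.subset_metricClosure _))
      (MeasureAlgebra.subset_metricClosure _) mk_range_le hY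
      (fun i : Y => BooleanSubalgebra.subset_closure ⟨i, rfl⟩) (ENNReal.half_pos hε.ne')
      fun α β hαβ => ?_
    rw [ENNReal.div_le_iff_le_mul (by simp) (by simp), mul_comm]
    exact (hYε α α.2).trans (leb_sdiff_le_leb_symmDiff_intervalElement h₁ h₂ hd
      fun h => hαβ (Subtype.ext h))

/-- Every free extension for the intervals embeds in the Maharam algebra, its new elements being
mapped to the interval elements. -/
theorem nonempty_orderIso_intervalSubalgebra (h₁ : Function.Injective j₁)
    (h₂ : Function.Injective j₂) (hd : ∀ k i, j₁ k ≠ j₂ i) (hab : ∀ i, a i < b i)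
    {B' : Type u} [BooleanAlgebra B'] {f : BoundedLatticeHom (MaharamAlgebra L) B'} {x : L → B'}
    (h : IsFreeExtension a b f x) :
    Nonempty (intervalSubalgebra h₁ a b j₂ ≃o BooleanSubalgebra.closure (range x)) := by
  obtain ⟨φ, hφ, hφx⟩ := (isFreeOver_gen h₁ hd h₂).exists_injective_hom (fun i => (hab i).le) h
  have : range (intervalElement (MeasureAlgebra.pullback (measurePreserving_coinMeasure_comp h₁))
      a b fun i => MaharamAlgebra.gen (j₂ i)) = φ '' range x := by
    rw [← range_comp]
    exact congrArg range (funext fun i => (hφx i).symm)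
  rw [intervalSubalgebra, this]
  exact BooleanSubalgebra.nonempty_closure_image_orderIso hφ _

end Main

/-! ### The support of the law of the interval elements -/

section Support

variable {I J Ω : Type u} [MeasurableSpace Ω] {μ : Measure Ω} {Q : Measure (I → Bool)}

/-- Events about finitely many coordinates of a random point, as elements of the measure
algebra. -/
def cylinderEvent (μ : Measure Ω) {w : Ω → I → Bool} (hw : Measurable w) :
    BoundedLatticeHom (cylinderAlgebra I) (MeasureAlgebra μ) where
  toFun C := MeasureAlgebra.mk μ ⟨w ⁻¹' C, hw (measurableSet_of_mem_cylinderAlgebra C.2)⟩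
  map_sup' _ _ := rfl
  map_inf' _ _ := rfl
  map_top' := rfl
  map_bot' := rfl

theorem cylinderEvent_mem {w : Ω → I → Bool} (hw : Measurable w)
    {S : BooleanSubalgebra (MeasureAlgebra μ)}
    (hS : ∀ i, MeasureAlgebra.mk μ ⟨{ω | w ω i = true},
      measurable_pi_iff.1 hw i (measurableSet_singleton true)⟩ ∈ S)
    (C : cylinderAlgebra I) : cylinderEvent μ hw C ∈ S := by
  obtain ⟨C, hC⟩ := C
  induction hC using BooleanSubalgebra.closure_bot_sup_induction with
  | mem x hx =>
    obtain ⟨i, rfl⟩ := hx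
    exact hS i
  | bot => exact S.bot_mem
  | sup x hx y hy h h' => exact S.sup_mem h h'
  | compl x hx h => exact S.compl_mem h

/-- A continuous surjection from the support onto a cube yields, by pulling back the coordinates,
an independent set of events. -/
theorem not_exists_continuous_surjective_cubeSupport {w : Ω → I → Bool} (hw : Measurable w)
    (hQ : ∀ C ∈ cylinderAlgebra I, Q C ≠ 0 → μ (w ⁻¹' C) ≠ 0)
    {S : BooleanSubalgebra (MeasureAlgebra μ)}
    (hS : ∀ i, MeasureAlgebra.mk μ ⟨{ω | w ω i = true},
      measurable_pi_iff.1 hw i (measurableSet_singleton true)⟩ ∈ S)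
    (hno : NoIndependentSubset #J (S : Set (MeasureAlgebra μ))) :
    ¬ ∃ φ : cubeSupport Q → (J → Bool), Continuous φ ∧ Function.Surjective φ := by
  classical
  rintro ⟨φ, hφ, hsurj⟩
  choose C hC hφC using exists_cylinder_of_continuous (isClosed_cubeSupport Q) hφ
  let c : J → cylinderAlgebra I := fun i => ⟨C i, hC i⟩
  have key : ∀ F G : Finset J, Disjoint F G → F.inf (fun i => cylinderEvent μ hw (c i)) ⊓
      G.inf (fun i => (cylinderEvent μ hw (c i))ᶜ) ≠ ⊥ := by
    intro F G hFG
    obtain ⟨p, hp⟩ := hsurj fun i => decide (i ∈ F)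
    have hpc : ∀ i, (p : BorelCube I).val ∈ C i ↔ i ∈ F := fun i => by
      rw [← hφC, hp, decide_eq_true_eq]
    have ht : IsTruthAssignment fun D : cylinderAlgebra I => (p : BorelCube I).val ∈ (D : Set _) :=
      ⟨fun _ _ => Iff.rfl, fun _ => Iff.rfl⟩
    have hD : cylinderEvent μ hw (F.inf c ⊓ G.inf fun i => (c i)ᶜ) =
        F.inf (fun i => cylinderEvent μ hw (c i)) ⊓
          G.inf (fun i => (cylinderEvent μ hw (c i))ᶜ) := by
      rw [map_inf, map_finset_inf, map_finset_inf]
      rfl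
    rw [← hD, ne_eq, ← MeasureAlgebra.leb_eq_zero]
    refine hQ _ (Subtype.property _) (p.2 _ (Subtype.property _) ((ht.inf _ _).2 ⟨?_, ?_⟩))
    · exact (ht.finset_inf _ _).2 fun i hi => (hpc i).2 hi
    · exact (ht.finset_inf _ _).2 fun i hi hi' =>
        Finset.disjoint_left.1 hFG ((hpc i).1 hi') hi
  refine hno ⟨range fun i => cylinderEvent μ hw (c i), ?_, isIndependent_range key,
    mk_range_eq _ (injective_of_inf_ne_bot key)⟩
  rintro _ ⟨i, rfl⟩
  exact cylinderEvent_mem hw hS _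

/-- The support of a law on a cube, with the Borel extension of that law, is a compact
zero-dimensional space whose measure algebra is that of the law. -/
theorem existsSpaceNotOntoCube_of_law {L : Type u} (hL : ℵ₀ < #L) [IsProbabilityMeasure Q]
    [LinearOrder L] [WellFoundedLT L] {f : (I → Bool) → L → ℝ}
    (hf : MeasurePreserving f Q (Measure.infinitePi fun _ : L => uniformMeasure))
    (hf' : EssentiallyInvertible Q f)
    (hno : ¬ ∃ φ : cubeSupport Q → (L → Bool), Continuous φ ∧ Function.Surjective φ) :
    ExistsSpaceNotOntoCube L := by
  obtain ⟨m, hm, hreg, hval, hval'⟩ := exists_regular_measure_cubeSupport Q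
  have : Infinite L := infinite_iff.2 hL.le
  obtain ⟨g, hg, hg'⟩ := exists_measurePreserving_uniform_coinMeasure (L := L)
  obtain ⟨e₁, he₁⟩ := MeasureAlgebra.exists_orderIso_of_measurePreserving (hf.comp hval)
    (hf'.comp hval' hval)
  obtain ⟨e₂, he₂⟩ := MeasureAlgebra.exists_orderIso_of_measurePreserving hg hg'
  have he : ∀ r, MeasureAlgebra.leb ((e₁.symm.trans e₂) r) = MeasureAlgebra.leb r := fun r => by
    rw [OrderIso.trans_apply, he₂, ← he₁, e₁.apply_symm_apply]
  have : CompactSpace (cubeSupport Q) :=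
    isCompact_iff_compactSpace.1 (isClosed_cubeSupport Q).isCompact
  exact ⟨cubeSupport Q, inferInstance, inferInstance, inferInstance, m, this, inferInstance,
    isTopologicalBasis_isClopen, hm, hreg, dimension_top_eq hL _ he, ⟨_, he⟩, hno⟩

end Support

section Space

variable {L : Type u} {a b : L → MaharamAlgebra L} {j₁ j₂ : L → L}

/-- The space is the support of the law of countably many blocks of interval elements, each
block covering the same event infinitely often; there the law is as rich as that of `#L` coins. -/
theorem existsSpaceNotOntoCube_of_intervalSubalgebra (hL : (#L).IsRegular) (hL' : ℵ₀ < #L)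
    (h₁ : Function.Injective j₁) (h₂ : Function.Injective j₂) (hd : ∀ k i, j₁ k ≠ j₂ i)
    (hab : ∀ i, a i < b i)
    (hno : NoIndependentSubset #L (intervalSubalgebra h₁ a b j₂ : Set (MaharamAlgebra L))) :
    ExistsSpaceNotOntoCube L := by
  have hrep : ∀ r : MaharamAlgebra L, ∃ s, MeasureAlgebra.mk _ s = r :=
    MeasureAlgebra.ind fun s => ⟨s, rfl⟩
  choose A hA using fun i => hrep (a i)
  choose B hB using fun i => hrep (b i)
  obtain ⟨E, hE, hE0, j, hj, hfreq⟩ := exists_blocks (P := coinMeasure L)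
    (c := fun i => (B i : Set (L → Bool)) \ A i) hL hL' (fun i h0 => by
      refine (hab i).not_ge (sdiff_eq_bot_iff.1 (MeasureAlgebra.leb_eq_zero.1 ?_))
      rw [← hA, ← hB]
      exact h0) fun i => (B i).2.diff (A i).2
  obtain ⟨_, hwf, -⟩ := exists_wellOrder_mk_Iio_lt L
  -- conditioning on `E` makes every block cover almost every point infinitely often
  let P := ProbabilityTheory.cond (coinMeasure L) E
  have hP : IsProbabilityMeasure P := ProbabilityTheory.cond_isProbabilityMeasure hE0
  have hPc : P ≪ coinMeasure L := ProbabilityTheory.cond_absolutelyContinuous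
  let a' : L × ℕ → Set (L → Bool) := fun i => A (j i)
  let b' : L × ℕ → Set (L → Bool) := fun i => B (j i)
  have ha' : ∀ i, MeasurableSet (a' i) := fun i => (A (j i)).2
  have hb' : ∀ i, MeasurableSet (b' i) := fun i => (B (j i)).2
  have hfill := measurable_fillIntervals (j := j) ha' hb'
  obtain ⟨f, hf, hf'⟩ := exists_measurePreserving_uniform (P := P) hj ha' hb' fun β => by
    filter_upwards [hPc.ae_le (hfreq β), ProbabilityTheory.ae_cond_mem hE] with ω h hω using h hω
  have := Measure.isProbabilityMeasure_map (μ := P.prod (coinMeasure L)) hfill.aemeasurable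
  have hΦ := measurePreserving_coinMeasure_prod h₁ h₂ hd
  refine existsSpaceNotOntoCube_of_law hL' hf hf'
    (not_exists_continuous_surjective_cubeSupport (μ := coinMeasure L)
      (hfill.comp hΦ.measurable) (fun C hC h0 => ?_) (fun i => ?_) hno)
  · have hCm := measurableSet_of_mem_cylinderAlgebra hC
    rw [Measure.map_apply hfill hCm] at h0
    rw [preimage_comp, hΦ.measure_preimage (hfill hCm).nullMeasurableSet]
    exact fun h => h0 (hPc.prod Measure.AbsolutelyContinuous.rfl h)
  · refine BooleanSubalgebra.subset_closure ⟨j i, ?_⟩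
    rw [intervalElement, ← hA, ← hB]
    refine congrArg (MeasureAlgebra.mk _) (Subtype.ext ?_)
    ext x
    simp [fillIntervals, a', b']

end Space

/-! ### Small sets of points under a strong limit cardinal of countable cofinality -/

section Cover

variable {M : Type u}

/-- A set of at most `#M` elements splits into countably many sets of fewer than `#M` elements if
the cofinality of `#M` is countable. -/
theorem exists_nat_valued_small_fibres (hM : ℵ₀ < #M) (hcof : (#M).ord.cof = ℵ₀) {Y : Type u}
    (hY : #Y ≤ #M) : ∃ r : Y → ℕ, ∀ n, #(r ⁻¹' {n}) < #M := by
  obtain ⟨_, _, hord⟩ := exists_ord_eq_type_lt M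
  have hc : Order.cof M = ℵ₀ := by rw [← Ordinal.cof_type, ← hord, hcof]
  obtain ⟨S, hS, hSc⟩ := Order.exists_cof_eq M
  have hScount : S.Countable := le_aleph0_iff_set_countable.1 (hSc.trans hc).le
  have hSne : S.Nonempty := by
    rw [nonempty_iff_ne_empty]
    rintro rfl
    rw [mk_eq_zero, hc] at hSc
    exact aleph0_ne_zero hSc.symm
  obtain ⟨s, rfl⟩ := hScount.exists_eq_range hSne
  obtain ⟨g⟩ := hY
  have hex : ∀ y, ∃ n, g y ≤ s n := fun y => by
    obtain ⟨_, ⟨n, rfl⟩, hn⟩ := hS (g y)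
    exact ⟨n, hn⟩
  choose r hr using hex
  refine ⟨r, fun n => ?_⟩
  have hIic : #(Iic (s n)) < #M := by
    rw [← Iio_insert]
    exact (mk_insert_le).trans_lt
      (add_lt_of_lt hM.le (mk_Iio_lt _ hord) (one_lt_aleph0.trans hM))
  refine (mk_le_of_injective (f := fun y : r ⁻¹' {n} => (⟨g y, ?_⟩ : Iic (s n))) ?_).trans_lt hIic
  · have h := hr y
    rwa [show r y = n from y.2] at h
  · intro y y' h
    exact Subtype.ext (g.injective (congrArg Subtype.val h))

/-- Fewer points than `#M` are all constant on a common infinite set of coordinates, hence on a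
common finite set of any given size. -/
theorem exists_finset_card_eq_forall_const (hM : (#M).IsStrongLimit) (hM' : ℵ₀ ≤ #M)
    {Y : Set (M → Bool)} (hY : #Y < #M) (n : ℕ) :
    ∃ F : Finset M, F.card = n ∧ ∀ y ∈ Y, ∃ s : Bool, ∀ i ∈ F, y i = s := by
  have : Infinite M := infinite_iff.2 hM'
  obtain ⟨v, hv⟩ := exists_infinite_fiber (fun (i : M) (y : Y) => y.1 i) (by
    rw [mk_pi, prod_const]
    simpa using hM.isStrongPrelimit hY)
  obtain ⟨F, hF, hFn⟩ := (infinite_coe_iff.1 hv).exists_subset_card_eq n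
  exact ⟨F, hFn, fun y hy => ⟨v ⟨y, hy⟩, fun i hi => congrFun (hF hi) ⟨y, hy⟩⟩⟩

theorem coinMeasure_setOf_eqOn (F : Finset M) (s : M → Bool) :
    coinMeasure M {x | ∀ i ∈ F, x i = s i} = 2⁻¹ ^ F.card := by
  have h := coinMeasure_inter_eq (T := ∅) (H := Set.univ) MeasurableSet.univ F
    (empty_disjoint _) s
  rwa [univ_inter, measure_univ, one_mul] at h

/-- Every set of at most `#M` points of the cube is covered by an open set of measure less than
one. -/
theorem exists_isOpen_coinMeasure_lt_one (hM : (#M).IsStrongLimit) (hM' : ℵ₀ < #M)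
    (hcof : (#M).ord.cof = ℵ₀) {Y : Set (M → Bool)} (hY : #Y ≤ #M) :
    ∃ O, IsOpen O ∧ MeasurableSet O ∧ Y ⊆ O ∧ coinMeasure M O < 1 := by
  obtain ⟨r, hr⟩ := exists_nat_valued_small_fibres hM' hcof hY
  have hr' : ∀ n, #(Subtype.val '' (r ⁻¹' {n}) : Set (M → Bool)) < #M := fun n =>
    mk_image_le.trans_lt (hr n)
  -- with `n + 3` coordinates, the two cylinders for the piece `n` have measure `2⁻¹ ^ (n + 2)`
  choose F hF hFY using fun n => exists_finset_card_eq_forall_const hM hM'.le (hr' n) (n + 3)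
  let C : ℕ → Bool → Set (M → Bool) := fun n s => {x | ∀ i ∈ F n, x i = s}
  have hC : ∀ n s, C n s ∈ cylinderAlgebra M := fun n s =>
    setOf_eqOn_mem_cylinderAlgebra (F n) fun _ => s
  have hCm : ∀ n s, coinMeasure M (C n s) = 2⁻¹ ^ (n + 3) := fun n s =>
    (coinMeasure_setOf_eqOn (F n) fun _ => s).trans (by rw [hF])
  refine ⟨⋃ n, ⋃ s, C n s, isOpen_iUnion fun n => isOpen_iUnion fun s =>
    (isClopen_of_mem_cylinderAlgebra (hC n s)).isOpen, MeasurableSet.iUnion fun n =>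
    MeasurableSet.iUnion fun s => measurableSet_of_mem_cylinderAlgebra (hC n s), ?_, ?_⟩
  · intro y hy
    obtain ⟨s, hs⟩ := hFY (r ⟨y, hy⟩) y ⟨⟨y, hy⟩, rfl, rfl⟩
    exact mem_iUnion₂.2 ⟨_, s, hs⟩
  · have hn : ∀ n, coinMeasure M (⋃ s, C n s) ≤ 2⁻¹ * 2⁻¹ ^ (n + 1) := fun n =>
      calc coinMeasure M (⋃ s, C n s) ≤ ∑ s, coinMeasure M (C n s) := measure_iUnion_fintype_le _ _
        _ = 2⁻¹ * 2⁻¹ ^ (n + 1) := by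
          simp only [hCm, Finset.sum_const, Finset.card_univ, Fintype.card_bool, nsmul_eq_mul]
          rw [pow_succ' _ (n + 2), pow_succ' _ (n + 1), ← mul_assoc]
          rw [Nat.cast_ofNat, ENNReal.mul_inv_cancel (by simp) (by simp), one_mul]
    calc coinMeasure M (⋃ n, ⋃ s, C n s) ≤ ∑' n, coinMeasure M (⋃ s, C n s) :=
          measure_iUnion_le _
      _ ≤ ∑' n : ℕ, 2⁻¹ * 2⁻¹ ^ (n + 1) := ENNReal.tsum_le_tsum hn
      _ = 2⁻¹ := by
        rw [ENNReal.tsum_mul_left, ENNReal.tsum_geometric_add_one, ENNReal.one_sub_inv_two,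
          inv_inv, ENNReal.inv_mul_cancel (by simp) (by simp), mul_one]
      _ < 1 := ENNReal.inv_lt_one.2 (by simp)

end Cover

/-! ### A strongly anti-independent sequence -/

section Sequence

variable {M L : Type u}

/-- Non-null compact sets, each point of the cube lying in few of them, form a strongly
anti-independent sequence: a truth assignment on the extension selects a point, and only the
intervals given by the sets through this point can be filled freely. -/
theorem stronglyAntiIndependent_of_isClosed {c : L → Set (M → Bool)} (hc : ∀ i, IsClosed (c i))
    (hcm : ∀ i, MeasurableSet (c i)) {κ : Cardinal.{u}}
    (hκ : #(M → Bool) * 2 ^ κ < 2 ^ #L) (hfew : ∀ z, #{i | z ∈ c i} ≤ κ) :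
    StronglyAntiIndependent #L (fun _ => (⊥ : MaharamAlgebra M))
      fun i => MeasureAlgebra.mk _ ⟨c i, hcm i⟩ := by
  classical
  refine ⟨fun _ => bot_le, fun B' _ f _ X _ x hx => ?_⟩
  refine noIndependentSubset_of_card_lt
    (R := Σ z : M → Bool, Set {i | z ∈ c i})
    (fun r p => ∃ i ∈ X, x i = p ∧ ∃ h : r.1 ∈ c i, ⟨i, h⟩ ∈ r.2) ?_ fun t ht => ?_
  · refine lt_of_le_of_lt ?_ hκ
    rw [mk_sigma]
    refine (sum_le_sum _ (fun _ => 2 ^ κ) fun z => ?_).trans (by simp)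
    rw [mk_set]
    exact power_le_power_left two_ne_zero (hfew z)
  · -- the closed sets accepted by `t` have the finite intersection property
    have hz : (⋂ i : {i // t (f (MeasureAlgebra.mk _ ⟨c i, hcm i⟩))}, c i).Nonempty := by
      refine CompactSpace.iInter_nonempty (fun i => hc i) fun u => ?_
      by_contra hemp
      rw [not_nonempty_iff_eq_empty] at hemp
      have hu : t (f (u.inf fun i => MeasureAlgebra.mk _ ⟨c i, hcm i⟩)) :=
        ((ht.comp f).finset_inf _ _).2 fun i _ => i.2
      have heq : ∀ v : Finset {i // t (f (MeasureAlgebra.mk _ ⟨c i, hcm i⟩))},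
          (v.inf fun i => (MeasureAlgebra.mk _ ⟨c i, hcm i⟩ : MaharamAlgebra M)) =
            MeasureAlgebra.mk _ ⟨⋂ i ∈ v, c i, Finset.measurableSet_biInter v fun i _ => hcm i⟩ := by
        intro v
        induction v using Finset.induction_on with
        | empty =>
          refine congrArg (MeasureAlgebra.mk _) (Subtype.ext ?_)
          simp
        | insert i v _ ih =>
          rw [Finset.inf_insert, ih]
          refine congrArg (MeasureAlgebra.mk _) (Subtype.ext ?_)
          exact (Finset.set_biInter_insert i v fun i => c i.1).symm
      rw [heq] at hu
      have hbot : (MeasureAlgebra.mk _ ⟨⋂ i ∈ u, c i,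
          Finset.measurableSet_biInter u fun i _ => hcm i⟩ : MaharamAlgebra M) = ⊥ :=
        congrArg (MeasureAlgebra.mk _) (Subtype.ext hemp)
      rw [hbot, map_bot] at hu
      exact ht.bot hu
    obtain ⟨z, hz⟩ := hz
    refine ⟨⟨z, {i | t (x i)}⟩, ?_⟩
    rintro _ ⟨i, hi, rfl⟩
    constructor
    · intro h
      exact ⟨i, hi, rfl, mem_iInter.1 hz ⟨i, ht.mono (hx i hi).2 h⟩, h⟩
    · rintro ⟨i', _, h', _, h⟩
      exact h' ▸ h

/-- Anti-independence is not lost when the base algebra is extended. -/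
theorem StronglyAntiIndependent.comp {A B I : Type u} [BooleanAlgebra A] [BooleanAlgebra B]
    {κ : Cardinal.{u}} {a b : I → A} (h : StronglyAntiIndependent κ a b)
    {g : BoundedLatticeHom A B} (hg : Function.Injective g) :
    StronglyAntiIndependent κ (fun i => g (a i)) fun i => g (b i) :=
  ⟨fun i => OrderHomClass.mono g (h.1 i), fun B' _ f hf X hX x hx =>
    h.2 B' (f.comp g) (hf.comp hg) X hX x hx⟩

/-- At a strong limit cardinal of countable cofinality where `2 ^ #M = (#M)⁺`, diagonalizing over
the open sets of small measure yields a strongly anti-independent sequence. -/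
theorem exists_stronglyAntiIndependent (hM : (#M).IsStrongLimit) (hM' : ℵ₀ < #M)
    (hcof : (#M).ord.cof = ℵ₀) (hL : #L = Order.succ #M) (hL' : #L = 2 ^ #M) :
    ∃ a b : L → MaharamAlgebra M, (∀ i, a i < b i) ∧ StronglyAntiIndependent #L a b := by
  have hcube : #(M → Bool) = #L := by rw [hL', mk_pi, prod_const]; simp
  obtain ⟨z⟩ := Cardinal.eq.1 hcube.symm
  obtain ⟨_, _, hIio⟩ := exists_wellOrder_mk_Iio_lt L
  have hIio' : ∀ i : L, #(Iio i) ≤ #M := fun i => Order.lt_succ_iff.1 (hL ▸ hIio i)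
  have hIic : ∀ i, #(z '' Iic i) ≤ #M := fun i => by
    refine mk_image_le.trans ?_
    rw [← Iio_insert]
    exact mk_insert_le.trans (add_le_of_le hM'.le (hIio' i) (one_le_aleph0.trans hM'.le))
  choose O hO hOm hzO hO1 using fun i => exists_isOpen_coinMeasure_lt_one hM hM' hcof (hIic i)
  refine ⟨fun _ => ⊥, fun i => MeasureAlgebra.mk _ ⟨(O i)ᶜ, (hOm i).compl⟩, fun i => ?_,
    stronglyAntiIndependent_of_isClosed (fun i => (hO i).isClosed_compl) (fun i => (hOm i).compl)
      (κ := #M) ?_ fun y => ?_⟩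
  · rw [bot_lt_iff_ne_bot, ne_eq, ← MeasureAlgebra.leb_eq_zero]
    change coinMeasure M (O i)ᶜ ≠ 0
    rw [ne_eq, prob_compl_eq_zero_iff (hOm i)]
    exact (hO1 i).ne
  · rw [← hL', hcube, mul_eq_self (hM'.le.trans (hL ▸ Order.le_succ _))]
    exact cantor _
  · -- the point with index `k` is covered by `O i` for all `i ≥ k`
    obtain ⟨k, rfl⟩ := z.surjective y
    refine (mk_le_mk_of_subset fun i hi => ?_).trans (hIio' k)
    by_contra hki
    exact hi (hzO i ⟨k, not_lt.1 hki, rfl⟩)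

end Sequence

/-! ### The algebra and the space of an anti-independent sequence -/

section Conclusion

variable {L : Type u} {a b : L → MaharamAlgebra L}

theorem exists_disjoint_injective (hL : ℵ₀ ≤ #L) : ∃ j₁ j₂ : L → L, Function.Injective j₁ ∧
    Function.Injective j₂ ∧ ∀ k i, j₁ k ≠ j₂ i := by
  have h : #(L ⊕ L) = #L := by rw [mk_sum, lift_id, add_eq_self hL]
  obtain ⟨e⟩ := Cardinal.eq.1 h
  exact ⟨e ∘ Sum.inl, e ∘ Sum.inr, e.injective.comp Sum.inl_injective,
    e.injective.comp Sum.inr_injective, fun k i hki => Sum.inl_ne_inr (e.injective hki)⟩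

/-- Half of the coordinates carry the given intervals, the other half the coins that fill them. -/
theorem conclusions_of_antiIndependent (hL : (#L).IsRegular) (hL' : ℵ₀ < #L)
    (hab : ∀ i, a i < b i) (h : StronglyAntiIndependent #L a b ∨ MediumlyAntiIndependent #L a b) :
    (∃ S : BooleanSubalgebra (MaharamAlgebra L), IsLargeWithoutIndependent S) ∧
      (∀ (B' : Type u) [BooleanAlgebra B'] (f : BoundedLatticeHom (MaharamAlgebra L) B')
        (x : L → B'), IsFreeExtension a b f x →
          ∃ S : BooleanSubalgebra (MaharamAlgebra L), IsLargeWithoutIndependent S ∧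
            Nonempty (S ≃o BooleanSubalgebra.closure (range x))) ∧
      ExistsSpaceNotOntoCube L := by
  obtain ⟨j₁, j₂, h₁, h₂, hd⟩ := exists_disjoint_injective hL'.le
  have hS := isLargeWithoutIndependent_intervalSubalgebra hL hL' h₁ h₂ hd hab h
  exact ⟨⟨_, hS⟩, fun B' _ f x hx =>
    ⟨_, hS, nonempty_orderIso_intervalSubalgebra h₁ h₂ hd hab hx⟩,
    existsSpaceNotOntoCube_of_intervalSubalgebra hL hL' h₁ h₂ hd hab hS.2.2⟩

end Conclusion

theorem mainTheorem1 :
    -- `#M` strong limit, singular of countable cofinality, and `#L = (#M)⁺ = 2 ^ #M`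
    (∀ M L : Type u, (#M).IsStrongLimit → ℵ₀ < #M → (#M).ord.cof = ℵ₀ →
      #L = Order.succ #M → #L = 2 ^ #M →
        (∃ a b : L → MaharamAlgebra M, (∀ i, a i < b i) ∧ StronglyAntiIndependent #L a b) ∧
        (∃ S : BooleanSubalgebra (MaharamAlgebra L), IsLargeWithoutIndependent S) ∧
        ExistsSpaceNotOntoCube L) ∧
    -- `#L` regular uncountable, with an anti-independent family of `#L` proper intervals
    (∀ L : Type u, (#L).IsRegular → ℵ₀ < #L →
      ∀ a b : L → MaharamAlgebra L, (∀ i, a i < b i) →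
        StronglyAntiIndependent #L a b ∨ MediumlyAntiIndependent #L a b →
          (∃ S : BooleanSubalgebra (MaharamAlgebra L), IsLargeWithoutIndependent S) ∧
          (∀ (B' : Type u) [BooleanAlgebra B'] (f : BoundedLatticeHom (MaharamAlgebra L) B')
            (x : L → B'), IsFreeExtension a b f x →
              ∃ S : BooleanSubalgebra (MaharamAlgebra L), IsLargeWithoutIndependent S ∧
                Nonempty (S ≃o BooleanSubalgebra.closure (range x))) ∧
          ExistsSpaceNotOntoCube L) := by
  refine ⟨fun M L hM hM' hcof hL hL' => ?_, fun L hL hL' a b hab h =>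
    conclusions_of_antiIndependent hL hL' hab h⟩
  obtain ⟨a, b, hab, h⟩ := exists_stronglyAntiIndependent hM hM' hcof hL hL'
  refine ⟨⟨a, b, hab, h⟩, ?_⟩
  have hML : #M ≤ #L := hL ▸ Order.le_succ _
  -- the sequence is moved into the larger Maharam algebra, along an injection of the coordinates
  obtain ⟨j⟩ := hML
  have hg := MeasureAlgebra.pullback_injective (measurePreserving_coinMeasure_comp j.injective)
  have hreg : (#L).IsRegular := hL ▸ isRegular_succ hM'.le
  have h2 := conclusions_of_antiIndependent hreg (hM'.trans_le ⟨j⟩)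
    (fun i => (OrderHomClass.mono _ (hab i).le).lt_of_ne (hg.ne (hab i).ne)) (Or.inl (h.comp hg))
  exact ⟨h2.1, h2.2.2⟩
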